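/- Let $G$ be a connected semisimple real algebraic group, i.e. the identity component of the group of real points of a semisimple linear algebraic group defined over $\mathbb R$, with Lie algebra $\mathfrak g$ and Killing form $B$. Let $K<G$ be a maximal compact subgroup, $\theta$ the associated Cartan involution of $\mathfrak g$, and $\mathfrak p=\{Y\in\mathfrak g:\theta Y=-Y\}$. Let $d$ be the distance on $G$ of the left-invariant Riemannian metric given on $\mathfrak g$ by $\langle Y,Z\rangle=-B(Y,\theta Z)$, and let $X=G/K$ be the Riemannian symmetric space, with the $G$-invariant metric given by $B$ on $T_oX=\mathfrak p$. Fix a (bi-invariant) Haar measure on $G$. Let $\Gamma<G$ be a discrete subgroup, and equip $\Gamma\backslash G$ with the induced $G$-invariant measure. For $x=\Gamma g\in\Gamma\backslash G$ let $\operatorname{inj}(x)\in[0,\infty]$ be the supremum of all $r>0$ such that $\{h\in G: d(h,g)<r\}$ injects into $\Gamma\backslash G$, and let $\operatorname{inj}(\Gamma\backslash G)=\sup_{x}\operatorname{inj}(x)$. The group $G$ acts unitarily on $L^2(G)$ and on $L^2(\Gamma\backslash G)$ by right translations. A unitary representation $\pi$ of $G$ is weakly contained in a unitary representation $\sigma$,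 written $\pi\propto\sigma$, if every diagonal matrix coefficient $g\mapsto\langle\pi(g)v,v\rangle$ of $\pi$ can be approximated, uniformly on compact subsets of $G$, by convex combinations of diagonal matrix coefficients of $\sigma$. Identify functions on $\Gamma\backslash X$ with right $K$-invariant functions on $\Gamma\backslash G$, and let $W^1(\Gamma\backslash X)\subset L^2(\Gamma\backslash X)$ be the closure of $C_c^\infty(\Gamma\backslash X)$ for the norm $\|f\|_{W^1}^2=\int|f|^2\,d\mathrm{vol}+\int\|\operatorname{grad}f\|^2\,d\mathrm{vol}$. Let $-\Delta$ be the self-adjoint operator on $L^2(\Gamma\backslash X)$ that extends the negative Laplace--Beltrami operator on $C_c^\infty(\Gamma\backslash X)$ and has domain in $W^1(\Gamma\backslash X)$: for $f\in W^1(\Gamma\backslash X)$ and $h\in L^2(\Gamma\backslash X)$, $-\Delta f=h$ means $\int\langle\operatorname{grad}f,\operatorname{grad}\psi\rangle\,d\mathrm{vol}=\int h\bar\psi\,d\mathrm{vol}$ for all $\psi\in C_c^\infty(\Gamma\backslash X)$. Its $L^2$-spectrum $\sigma(\Gamma\backslash X)$ is the set of all $\lambda\in\mathbb C$ such that $-\Delta-\lambda$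 has no bounded inverse; $\sigma(X)$ is the case of trivial $\Gamma$. If $\operatorname{inj}(\Gamma\backslash G)=\infty$, then $$L^2(G)\propto L^2(\Gamma\backslash G)\qquad\text{and}\qquad\sigma(X)\subset\sigma(\Gamma\backslash X).$$ -/

import Mathlib

open MeasureTheory Filter Topology
open scoped ENNReal NNReal ContDiff MulOpposite ComplexConjugate

noncomputable section

/-! ### Closed linear groups, their exponential map and their Lie algebra -/

instance ClosedSubgroup.instIsTopologicalGroup {A : Type*} [Group A] [TopologicalSpace A]
    [IsTopologicalGroup A] (G : ClosedSubgroup A) : IsTopologicalGroup G :=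
  inferInstanceAs (IsTopologicalGroup G.toSubgroup)

section Exponential

/-- The matrix exponential, with values in the invertible matrices. -/
def expGL {n : ℕ} (Y : Matrix (Fin n) (Fin n) ℝ) : GL (Fin n) ℝ :=
  (Matrix.isUnit_exp Y).unit

theorem coe_expGL {n : ℕ} (Y : Matrix (Fin n) (Fin n) ℝ) :
    (expGL Y : Matrix (Fin n) (Fin n) ℝ) = NormedSpace.exp Y := rfl

theorem norm_pow_sub_pow_le {A : Type*} [NormedRing A] {a b : A} {M : ℝ} (hM : 1 ≤ M)
    (ha : ‖a‖ ≤ M) (hb : ‖b‖ ≤ M) (m : ℕ) : ‖a ^ m - b ^ m‖ ≤ m * M ^ m * ‖a - b‖ := by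
  have hM0 : 0 ≤ M := zero_le_one.trans hM
  induction m with
  | zero => simp
  | succ m ih =>
    rcases Nat.eq_zero_or_pos m with rfl | hm
    · simpa using le_mul_of_one_le_left (norm_nonneg (a - b)) hM
    have key : a ^ (m + 1) - b ^ (m + 1) = a ^ m * (a - b) + (a ^ m - b ^ m) * b := by
      rw [pow_succ, pow_succ]; noncomm_ring
    have h1 : ‖a ^ m * (a - b)‖ ≤ M ^ (m + 1) * ‖a - b‖ := by
      refine (norm_mul_le _ _).trans (mul_le_mul_of_nonneg_right ?_ (norm_nonneg _))
      exact ((norm_pow_le' a hm).trans (pow_le_pow_left₀ (norm_nonneg _) ha m)).trans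
        (pow_le_pow_right₀ hM (Nat.le_succ m))
    have h2 : ‖(a ^ m - b ^ m) * b‖ ≤ m * M ^ (m + 1) * ‖a - b‖ := by
      refine (norm_mul_le _ _).trans ?_
      calc ‖a ^ m - b ^ m‖ * ‖b‖ ≤ (m * M ^ m * ‖a - b‖) * M :=
            mul_le_mul ih hb (norm_nonneg _) (by positivity)
        _ = m * M ^ (m + 1) * ‖a - b‖ := by ring
    rw [key]
    refine (norm_add_le _ _).trans ((add_le_add h1 h2).trans (le_of_eq ?_))
    push_cast; ring

/-- The Lie product formula in a real Banach algebra. -/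
theorem tendsto_exp_mul_exp_pow {A : Type*} [NormedRing A] [NormedAlgebra ℝ A] [CompleteSpace A]
    (one : ‖(1 : A)‖ ≤ 1) (X Y : A) :
    Tendsto (fun m : ℕ => (NormedSpace.exp (((m : ℝ)⁻¹) • X) *
      NormedSpace.exp (((m : ℝ)⁻¹) • Y)) ^ m) atTop (𝓝 (NormedSpace.exp (X + Y))) := by
  let _ : NormedAlgebra ℚ A := NormedAlgebra.restrictScalars ℚ ℝ A
  obtain ⟨c, hc⟩ : ∃ c : ℝ → A, c = fun t => NormedSpace.exp (t • X) * NormedSpace.exp (t • Y) :=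
    ⟨_, rfl⟩
  obtain ⟨b, hb⟩ : ∃ b : ℝ → A, b = fun t => NormedSpace.exp (t • (X + Y)) := ⟨_, rfl⟩
  have hc' : HasDerivAt c (X + Y) 0 := by
    have := (hasDerivAt_exp_smul_const (𝕂 := ℝ) X 0).mul (hasDerivAt_exp_smul_const (𝕂 := ℝ) Y 0)
    rw [hc]
    simpa only [zero_smul, NormedSpace.exp_zero, one_mul, mul_one, Pi.mul_def] using this
  have hb' : HasDerivAt b (X + Y) 0 := by
    have := hasDerivAt_exp_smul_const (𝕂 := ℝ) (X + Y) 0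
    rw [hb]
    simpa only [zero_smul, NormedSpace.exp_zero, one_mul] using this
  have h0 : Tendsto (fun m : ℕ => ((m : ℝ)⁻¹)) atTop (𝓝[≠] 0) := by
    refine tendsto_nhdsWithin_iff.2 ⟨tendsto_inv_atTop_nhds_zero_nat, ?_⟩
    filter_upwards [eventually_gt_atTop 0] with m hm
    simpa using hm.ne'
  have sc := (hc'.tendsto_slope_zero.comp h0)
  have sb := (hb'.tendsto_slope_zero.comp h0)
  have c0 : c 0 = 1 := by simp [hc]
  have b0 : b 0 = 1 := by simp [hb]
  simp only [Function.comp_def, zero_add, inv_inv, c0, b0] at sc sb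
  obtain ⟨C, hC⟩ : ∃ C : ℝ, ∀ᶠ m : ℕ in atTop,
      ‖(m : ℝ) • (c (m : ℝ)⁻¹ - 1)‖ ≤ C ∧ ‖(m : ℝ) • (b (m : ℝ)⁻¹ - 1)‖ ≤ C := by
    refine ⟨‖X + Y‖ + 1, ?_⟩
    filter_upwards [sc.norm.eventually_le_const (lt_add_one ‖X + Y‖),
      sb.norm.eventually_le_const (lt_add_one ‖X + Y‖)] with m h1 h2 using ⟨h1, h2⟩
  have hdiff : Tendsto (fun m : ℕ => Real.exp C * ‖(m : ℝ) • (c (m : ℝ)⁻¹ - b (m : ℝ)⁻¹)‖)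
      atTop (𝓝 0) := by
    have := (sc.sub sb).norm.const_mul (Real.exp C)
    simp only [sub_self, norm_zero, mul_zero] at this
    refine this.congr fun m => ?_
    rw [← smul_sub]; congr 3; abel
  have hbpow : ∀ᶠ m : ℕ in atTop, b (m : ℝ)⁻¹ ^ m = NormedSpace.exp (X + Y) := by
    filter_upwards [eventually_gt_atTop 0] with m hm
    have hm' : (m : ℝ) ≠ 0 := by exact_mod_cast hm.ne'
    rw [hb, ← NormedSpace.exp_nsmul, ← Nat.cast_smul_eq_nsmul ℝ, smul_smul, mul_inv_cancel₀ hm',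
      one_smul]
  have goal_eq : (fun m : ℕ => (NormedSpace.exp (((m : ℝ)⁻¹) • X) *
      NormedSpace.exp (((m : ℝ)⁻¹) • Y)) ^ m) = fun m : ℕ => c (m : ℝ)⁻¹ ^ m := by rw [hc]
  rw [goal_eq, tendsto_iff_norm_sub_tendsto_zero]
  refine squeeze_zero' (Eventually.of_forall fun _ => norm_nonneg _) ?_ hdiff
  filter_upwards [hC, hbpow, eventually_gt_atTop 0] with m hm hbm hpos
  have hm' : (0 : ℝ) < m := by exact_mod_cast hpos
  have bound : ∀ a : A, ‖(m : ℝ) • (a - 1)‖ ≤ C →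
      ‖a‖ ≤ Real.exp (C / m) := by
    intro a ha
    rw [norm_smul, Real.norm_of_nonneg hm'.le] at ha
    have h1 : ‖a - 1‖ ≤ C / m := by rw [le_div_iff₀ hm']; linarith
    have h2 : ‖a‖ ≤ ‖a - 1‖ + ‖(1 : A)‖ := by
      simpa using norm_add_le (a - 1) 1
    linarith [Real.add_one_le_exp (C / m)]
  have hC0 : 0 ≤ C := (norm_nonneg _).trans hm.1
  have h := norm_pow_sub_pow_le (Real.one_le_exp (div_nonneg hC0 hm'.le))
    (bound _ hm.1) (bound _ hm.2) m
  rw [hbm, ← Real.exp_nat_mul, mul_div_cancel₀ _ hm'.ne'] at h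
  rw [norm_smul, Real.norm_of_nonneg hm'.le]
  calc _ ≤ _ := h
    _ = _ := by ring

theorem tendsto_conj_exp {A : Type*} [NormedRing A] [NormedAlgebra ℝ A] [CompleteSpace A]
    (X Y : A) : Tendsto (fun t : ℝ => t⁻¹ •
      (NormedSpace.exp (t • X) * Y * NormedSpace.exp (t • (-X)) - Y)) (𝓝[≠] 0)
      (𝓝 (X * Y - Y * X)) := by
  have := (((hasDerivAt_exp_smul_const (𝕂 := ℝ) X 0).mul_const Y).mul
    (hasDerivAt_exp_smul_const (𝕂 := ℝ) (-X) 0)).tendsto_slope_zero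
  simpa only [zero_smul, NormedSpace.exp_zero, one_mul, mul_one, mul_neg, ← sub_eq_add_neg,
    zero_add, Pi.mul_def] using this

theorem tendsto_exp_mul_exp_pow_matrix {n : ℕ} (X Y : Matrix (Fin n) (Fin n) ℝ) :
    Tendsto (fun m : ℕ => (NormedSpace.exp (((m : ℝ)⁻¹) • X) *
      NormedSpace.exp (((m : ℝ)⁻¹) • Y)) ^ m) atTop (𝓝 (NormedSpace.exp (X + Y))) := by
  let _ : NormedRing (Matrix (Fin n) (Fin n) ℝ) := Matrix.linftyOpNormedRing
  let _ : NormedAlgebra ℝ (Matrix (Fin n) (Fin n) ℝ) := Matrix.linftyOpNormedAlgebra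
  have one : ‖(1 : Matrix (Fin n) (Fin n) ℝ)‖ ≤ 1 := by
    rcases Nat.eq_zero_or_pos n with rfl | hn
    · rw [Subsingleton.elim (1 : Matrix (Fin 0) (Fin 0) ℝ) 0]; simp
    · have : Nonempty (Fin n) := ⟨⟨0, hn⟩⟩
      have : NormOneClass (Matrix (Fin n) (Fin n) ℝ) := Matrix.linfty_opNormOneClass
      exact norm_one.le
  exact tendsto_exp_mul_exp_pow one X Y

theorem tendsto_conj_exp_matrix {n : ℕ} (X Y : Matrix (Fin n) (Fin n) ℝ) :
    Tendsto (fun t : ℝ => t⁻¹ •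
      (NormedSpace.exp (t • X) * Y * NormedSpace.exp (t • (-X)) - Y)) (𝓝[≠] 0)
      (𝓝 (X * Y - Y * X)) := by
  let _ : NormedRing (Matrix (Fin n) (Fin n) ℝ) := Matrix.linftyOpNormedRing
  let _ : NormedAlgebra ℝ (Matrix (Fin n) (Fin n) ℝ) := Matrix.linftyOpNormedAlgebra
  exact tendsto_conj_exp X Y

end Exponential

end

attribute [local instance 100] LieRing.ofAssociativeRing

noncomputable section

/-- The Lie algebra of a closed subgroup `G` of `GL_n(ℝ)`: all real matrices `Y` such that
`exp (t Y) ∈ G` for all real `t`, with the commutator bracket. -/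
def lieAlgebra {n : ℕ} (G : ClosedSubgroup (GL (Fin n) ℝ)) :
    LieSubalgebra ℝ (Matrix (Fin n) (Fin n) ℝ) :=
  let S : Submodule ℝ (Matrix (Fin n) (Fin n) ℝ) :=
    { carrier := {Y | ∀ t : ℝ, expGL (t • Y) ∈ G}
      add_mem' := by
        intro X Y hX hY t
        have hlim := tendsto_exp_mul_exp_pow_matrix (t • X) (t • Y)
        have hcl : IsClosed (G : Set (GL (Fin n) ℝ)) := G.isClosed'
        have hinv := tendsto_exp_mul_exp_pow_matrix (-(t • Y)) (-(t • X))
        have h1 : Tendsto (fun m : ℕ => (expGL (((m : ℝ)⁻¹) • (t • X)) *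
            expGL (((m : ℝ)⁻¹) • (t • Y))) ^ m) atTop (𝓝 (expGL (t • (X + Y)))) := by
          rw [Units.isEmbedding_embedProduct.tendsto_nhds_iff, nhds_prod_eq]
          refine Tendsto.prodMk ?_ ?_
          · simpa [Function.comp_def, Units.embedProduct, coe_expGL, smul_add] using hlim
          · refine (MulOpposite.continuous_op.tendsto _).comp ?_
            have key : ∀ Z : Matrix (Fin n) (Fin n) ℝ,
                (((expGL Z)⁻¹ : GL (Fin n) ℝ) : Matrix (Fin n) (Fin n) ℝ) =
                  NormedSpace.exp (-Z) := by
              intro Z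
              rw [Matrix.coe_units_inv, coe_expGL, Matrix.exp_neg]
            simp only [← inv_pow, mul_inv_rev, Units.val_pow_eq_pow_val, Units.val_mul, key]
            have e1 : -(t • Y) + -(t • X) = -(t • (X + Y)) := by rw [smul_add]; abel
            rw [e1] at hinv
            simpa using hinv
        refine hcl.mem_of_tendsto h1 (Eventually.of_forall fun m => ?_)
        refine pow_mem (mul_mem ?_ ?_) m
        · rw [smul_smul]; exact hX _
        · rw [smul_smul]; exact hY _
      zero_mem' := by
        intro t
        have : expGL (t • (0 : Matrix (Fin n) (Fin n) ℝ)) = 1 := by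
          ext1; simp [coe_expGL]
        rw [this]; exact one_mem G
      smul_mem' := by
        intro a Y hY t
        rw [smul_smul]; exact hY _ }
  { S with
    lie_mem' := by
      intro X Y hX hY
      have hconj : ∀ t : ℝ, NormedSpace.exp (t • X) * Y * NormedSpace.exp (t • (-X)) ∈ S := by
        intro t s
        have hXt : (((expGL (t • X))⁻¹ : GL (Fin n) ℝ) : Matrix (Fin n) (Fin n) ℝ) =
            NormedSpace.exp (t • (-X)) := by
          rw [Matrix.coe_units_inv, coe_expGL, smul_neg, Matrix.exp_neg]
        have : expGL (s • (NormedSpace.exp (t • X) * Y * NormedSpace.exp (t • (-X)))) =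
            expGL (t • X) * expGL (s • Y) * (expGL (t • X))⁻¹ := by
          ext1
          rw [coe_expGL, ← hXt, ← coe_expGL (t • X), ← smul_mul_assoc, ← mul_smul_comm,
            Matrix.exp_units_conj]
          rfl
        rw [this]
        exact mul_mem (mul_mem (hX t) (hY s)) (inv_mem (hX t))
      have hcl : IsClosed (S : Set (Matrix (Fin n) (Fin n) ℝ)) :=
        Submodule.closed_of_finiteDimensional S
      refine hcl.mem_of_tendsto (tendsto_conj_exp_matrix X Y) (Eventually.of_forall fun t => ?_)
      exact S.smul_mem _ (S.sub_mem (hconj _) hY) }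

/-- The exponential map `𝔤 → G`. -/
def expG {n : ℕ} {G : ClosedSubgroup (GL (Fin n) ℝ)} (Y : lieAlgebra G) : G :=
  ⟨expGL (Y : Matrix (Fin n) (Fin n) ℝ), by
    have h : ∀ t : ℝ, expGL (t • (Y : Matrix (Fin n) (Fin n) ℝ)) ∈ G := Y.2
    simpa using h 1⟩

/-! ### Connected semisimple real algebraic groups -/

/-- A subgroup of `GL_n(ℝ)` which is the zero locus in `GL_n(ℝ)` of a set of real polynomials in
the matrix entries, i.e. the group of real points of a linear algebraic group over `ℝ`. -/
def IsRealAlgebraic {n : ℕ} (H : Subgroup (GL (Fin n) ℝ)) : Prop :=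
  ∃ S : Set (MvPolynomial (Fin n × Fin n) ℝ), ∀ g : GL (Fin n) ℝ,
    g ∈ H ↔ ∀ p ∈ S,
      MvPolynomial.eval (fun ij => (g : Matrix (Fin n) (Fin n) ℝ) ij.1 ij.2) p = 0

/-- `G` is a connected semisimple real algebraic group: the identity component (for the Euclidean
topology) of a group of real points, with semisimple Lie algebra. -/
structure IsConnectedSemisimpleRealAlgebraic {n : ℕ} (G : ClosedSubgroup (GL (Fin n) ℝ)) :
    Prop where
  algebraic : ∃ H : Subgroup (GL (Fin n) ℝ), IsRealAlgebraic H ∧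
    (G : Set (GL (Fin n) ℝ)) = connectedComponentIn (H : Set (GL (Fin n) ℝ)) 1
  semisimple : LieAlgebra.IsSemisimple ℝ (lieAlgebra G)

/-- `K` is a maximal compact subgroup of `G` and `θ` is the Cartan involution of `𝔤` attached to
it: `θ` is an involutive automorphism of `𝔤`, the form `-B(Y, θ Z)` (`B` the Killing form) is
positive definite, and the fixed points of `θ` are the Lie algebra of `K`. -/
structure IsCartanPair {n : ℕ} {G : ClosedSubgroup (GL (Fin n) ℝ)} (K : Subgroup G)
    (θ : lieAlgebra G ≃ₗ⁅ℝ⁆ lieAlgebra G) : Prop where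
  isCompact : IsCompact (K : Set G)
  maximal : ∀ L : Subgroup G, IsCompact (L : Set G) → K ≤ L → L = K
  involutive : ∀ Y, θ (θ Y) = Y
  posDef : ∀ Y, Y ≠ 0 → 0 < -killingForm ℝ (lieAlgebra G) Y (θ Y)
  fixed : ∀ Y, θ Y = Y ↔ ∀ t : ℝ, expG (t • Y) ∈ K

/-- `e` is an orthonormal basis, for the Killing form, of the `(-1)`-eigenspace `𝔭` of `θ`, i.e. of
the tangent space of `X = G/K` at the base point. -/
structure IsOrthonormalFrame {n : ℕ} {G : ClosedSubgroup (GL (Fin n) ℝ)}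
    (θ : lieAlgebra G ≃ₗ⁅ℝ⁆ lieAlgebra G) {d : ℕ} (e : Fin d → lieAlgebra G) : Prop where
  mem : ∀ i, θ (e i) = -e i
  orthonormal : ∀ i j, killingForm ℝ (lieAlgebra G) (e i) (e j) = if i = j then 1 else 0
  spans : ∀ Y, θ Y = -Y → Y ∈ Submodule.span ℝ (Set.range e)

/-! ### The left invariant Riemannian distance on `G` -/

/-- The norm on `𝔤` of the inner product `⟨Y, Z⟩ = -B(Y, θ Z)`. -/
def cartanNorm {n : ℕ} {G : ClosedSubgroup (GL (Fin n) ℝ)}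
    (θ : lieAlgebra G ≃ₗ⁅ℝ⁆ lieAlgebra G) (Y : lieAlgebra G) : ℝ :=
  Real.sqrt (-killingForm ℝ (lieAlgebra G) Y (θ Y))

/-- `c` is a `C¹` curve `[0,1] → G` with `c'(t) = c(t) Y(t)`, `Y(t) ∈ 𝔤`. -/
def IsC1Curve {n : ℕ} {G : ClosedSubgroup (GL (Fin n) ℝ)} (c : ℝ → G) (Y : ℝ → lieAlgebra G) :
    Prop :=
  ContinuousOn Y (Set.Icc 0 1) ∧ ∀ t ∈ Set.Icc (0 : ℝ) 1, ∀ i j : Fin n,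
    HasDerivWithinAt (fun s : ℝ => ((c s : GL (Fin n) ℝ) : Matrix (Fin n) (Fin n) ℝ) i j)
      ((((c t : GL (Fin n) ℝ) : Matrix (Fin n) (Fin n) ℝ) *
        (Y t : Matrix (Fin n) (Fin n) ℝ)) i j) (Set.Icc 0 1) t

/-- The distance on `G` of the left invariant Riemannian metric which is `-B(Y, θ Z)` on `𝔤`: the
infimum of the lengths of the `C¹` curves from `g` to `h`. -/
def riemannianDist {n : ℕ} {G : ClosedSubgroup (GL (Fin n) ℝ)}
    (θ : lieAlgebra G ≃ₗ⁅ℝ⁆ lieAlgebra G) (g h : G) : ℝ≥0∞ :=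
  ⨅ (c : ℝ → G) (Y : ℝ → lieAlgebra G) (_ : IsC1Curve c Y ∧ c 0 = g ∧ c 1 = h),
    ENNReal.ofReal (∫ t in (0 : ℝ)..1, cartanNorm θ (Y t))

/-! ### The quotient `Γ\G` -/

/-- The space `Γ\G` of cosets `Γ g`. -/
def RightCosets {G : Type*} [Group G] (Γ : Subgroup G) : Type _ :=
  Quotient (QuotientGroup.rightRel Γ)

namespace RightCosets

section

variable {G : Type*} [Group G] (Γ : Subgroup G)

/-- The projection `g ↦ Γ g`. -/
def mk (g : G) : RightCosets Γ := Quotient.mk (QuotientGroup.rightRel Γ) g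

theorem mk_eq_mk {g h : G} : mk Γ g = mk Γ h ↔ h * g⁻¹ ∈ Γ :=
  Quotient.eq.trans QuotientGroup.rightRel_apply

/-- The right action of `G` on `Γ\G`, written as a left action of the opposite group:
`op g • Γ x = Γ x g`. -/
instance : MulAction Gᵐᵒᵖ (RightCosets Γ) where
  smul g := Quotient.map (fun x => x * g.unop) (by
    intro a b hab
    have hab' : b * a⁻¹ ∈ Γ := QuotientGroup.rightRel_apply.1 hab
    refine QuotientGroup.rightRel_apply.2 ?_
    have : b * g.unop * (a * g.unop)⁻¹ = b * a⁻¹ := by group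
    rwa [this])
  one_smul := by
    rintro ⟨x⟩
    exact congrArg (mk Γ) (mul_one x)
  mul_smul := by
    rintro g h ⟨x⟩
    exact congrArg (mk Γ) (mul_assoc x h.unop g.unop).symm

theorem op_smul_mk (g x : G) : MulOpposite.op g • mk Γ x = mk Γ (x * g) := rfl

variable [TopologicalSpace G]

/-- The quotient topology. -/
instance : TopologicalSpace (RightCosets Γ) :=
  inferInstanceAs (TopologicalSpace (Quotient (QuotientGroup.rightRel Γ)))

instance : MeasurableSpace (RightCosets Γ) := borel _

instance : BorelSpace (RightCosets Γ) := ⟨rfl⟩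

theorem continuous_mk : Continuous (mk Γ) := continuous_quot_mk

variable [IsTopologicalGroup G]

instance : ContinuousConstSMul Gᵐᵒᵖ (RightCosets Γ) where
  continuous_const_smul g := by
    refine continuous_quot_lift _ ?_
    exact (continuous_mk Γ).comp (continuous_mul_const g.unop)

variable [MeasurableSpace G] [BorelSpace G]

/-- The measure on `Γ\G` induced by a measure `μ` on `G`: the smallest measure which is at least
the image of `μ` restricted to `U`, for every open `U ⊆ G` that injects into `Γ\G`. If `μ` is a
Haar measure and `Γ` is discrete, this is the measure for which the injections `U → Γ\G` preserve
the measure, i.e. `∫_G f dμ = ∫_{Γ\G} ∑_{γ ∈ Γ} f(γ g) d(Γ g)`. -/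
def quotientMeasure (μ : Measure G) : Measure (RightCosets Γ) :=
  ⨆ (U : Set G) (_ : IsOpen U ∧ Set.InjOn (mk Γ) U), (μ.restrict U).map (mk Γ)

theorem le_map_quotientMeasure (μ : Measure G) [μ.IsMulRightInvariant] (g : G) :
    quotientMeasure Γ μ ≤ (quotientMeasure Γ μ).map (MulOpposite.op g • ·) := by
  refine iSup₂_le fun U hU => ?_
  have hmk : Measurable (mk Γ) := (continuous_mk Γ).measurable
  have hT : ∀ k : G, Measurable (fun x : RightCosets Γ => MulOpposite.op k • x) := fun k =>
    (continuous_const_smul (MulOpposite.op k)).measurable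
  have hV : IsOpen ((· * g) ⁻¹' U) ∧ Set.InjOn (mk Γ) ((· * g) ⁻¹' U) := by
    refine ⟨hU.1.preimage (continuous_mul_const g), fun a ha b hb hab => ?_⟩
    have : mk Γ (a * g) = mk Γ (b * g) := by
      rw [← op_smul_mk, ← op_smul_mk, hab]
    exact mul_right_cancel (hU.2 ha hb this)
  have h1 : (μ.restrict U).map (mk Γ) =
      ((μ.restrict ((· * g) ⁻¹' U)).map (mk Γ)).map (MulOpposite.op g • ·) := by
    rw [Measure.map_map (hT g) hmk]
    have : (fun x : RightCosets Γ => MulOpposite.op g • x) ∘ mk Γ = mk Γ ∘ (· * g) := rfl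
    rw [this, ← Measure.map_map hmk (continuous_mul_const g).measurable,
      ← Measure.restrict_map (continuous_mul_const g).measurable hU.1.measurableSet,
      map_mul_right_eq_self]
  rw [h1]
  exact Measure.map_mono (le_iSup₂_of_le _ hV le_rfl) (hT g)

/-- The induced measure is `G`-invariant. -/
instance (μ : Measure G) [μ.IsMulRightInvariant] :
    SMulInvariantMeasure Gᵐᵒᵖ (RightCosets Γ) (quotientMeasure Γ μ) where
  measure_preimage_smul := by
    intro g s hs
    have hT : ∀ k : Gᵐᵒᵖ, Measurable (fun x : RightCosets Γ => k • x) := fun k =>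
      (continuous_const_smul k).measurable
    refine le_antisymm ?_ ?_
    · have := le_map_quotientMeasure Γ μ (g⁻¹).unop ((fun x => g • x) ⁻¹' s)
      rw [Measure.map_apply (hT _) (hT g hs)] at this
      simpa [← Set.preimage_comp, Function.comp_def] using this
    · have := le_map_quotientMeasure Γ μ g.unop s
      rwa [Measure.map_apply (hT _) hs] at this

end

end RightCosets

/-! ### Injectivity radius -/

/-- The injectivity radius at `Γ g`: the supremum of all `r` such that the ball of radius `r` about
`g` injects into `Γ\G`. -/
def injRadiusAt {n : ℕ} {G : ClosedSubgroup (GL (Fin n) ℝ)}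
    (θ : lieAlgebra G ≃ₗ⁅ℝ⁆ lieAlgebra G) (Γ : Subgroup G) (g : G) : ℝ≥0∞ :=
  ⨆ (r : ℝ≥0) (_ : Set.InjOn (RightCosets.mk Γ) {h : G | riemannianDist θ h g < r}), (r : ℝ≥0∞)

/-- The injectivity radius of `Γ\G`. -/
def injRadius {n : ℕ} {G : ClosedSubgroup (GL (Fin n) ℝ)}
    (θ : lieAlgebra G ≃ₗ⁅ℝ⁆ lieAlgebra G) (Γ : Subgroup G) : ℝ≥0∞ :=
  ⨆ g : G, injRadiusAt θ Γ g

/-! ### Quasi-regular representations and weak containment -/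

/-- The unitary representation of `G` on `L²(Ω, ν)` given by a measure preserving right action of
`G` on `Ω`: `(g f)(x) = f(x g)`. -/
def rightRep (G : Type*) [Group G] (Ω : Type*) [MulAction Gᵐᵒᵖ Ω] [MeasurableSpace Ω]
    [MeasurableConstSMul Gᵐᵒᵖ Ω] (ν : Measure Ω) [SMulInvariantMeasure Gᵐᵒᵖ Ω ν] :
    G →* (Lp ℂ 2 ν ≃ₗᵢ[ℂ] Lp ℂ 2 ν) where
  toFun g :=
    { toFun := fun f => DomMulAct.mk (MulOpposite.op g) • f
      invFun := fun f => DomMulAct.mk (MulOpposite.op g⁻¹) • f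
      left_inv := fun f => by
        change DomMulAct.mk _ • DomMulAct.mk _ • f = f
        rw [smul_smul, ← DomMulAct.mk_mul, ← MulOpposite.op_mul]
        simp
      right_inv := fun f => by
        change DomMulAct.mk _ • DomMulAct.mk _ • f = f
        rw [smul_smul, ← DomMulAct.mk_mul, ← MulOpposite.op_mul]
        simp
      map_add' := fun f h => smul_add _ f h
      map_smul' := fun a f => smul_comm _ a f
      norm_map' := fun f => DomMulAct.norm_smul_Lp _ f }
  map_one' := by
    ext1 f
    exact one_smul (Gᵐᵒᵖᵈᵐᵃ) f
  map_mul' g h := by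
    ext1 f
    exact mul_smul (DomMulAct.mk (MulOpposite.op g)) (DomMulAct.mk (MulOpposite.op h)) f

/-- Weak containment of the unitary representation `π` in `σ`: every diagonal matrix coefficient
of `π` is approximated, uniformly on compact sets, by convex combinations of diagonal matrix
coefficients of `σ`. -/
def WeaklyContained {G : Type*} [Group G] [TopologicalSpace G]
    {V W : Type*} [NormedAddCommGroup V] [InnerProductSpace ℂ V]
    [NormedAddCommGroup W] [InnerProductSpace ℂ W]
    (π : G →* (V ≃ₗᵢ[ℂ] V)) (σ : G →* (W ≃ₗᵢ[ℂ] W)) : Prop :=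
  ∀ v : V, ∀ Q : Set G, IsCompact Q → ∀ ε : ℝ, 0 < ε →
    ∃ (m : ℕ) (a : Fin m → ℝ) (w : Fin m → W), (∀ i, 0 ≤ a i) ∧ ∑ i, a i = 1 ∧
      ∀ g ∈ Q, ‖inner ℂ v (π g v) - ∑ i, (a i : ℂ) * inner ℂ (w i) (σ g (w i))‖ < ε

/-! ### The Laplace operator on `Γ\X` and its spectrum

Functions on `Γ\X = Γ\G/K` are identified with right `K`-invariant functions on `Γ\G`. -/

section Laplace

variable {n : ℕ} {G : ClosedSubgroup (GL (Fin n) ℝ)} [MeasurableSpace G] [BorelSpace G]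

/-- The derivative of `φ` along the left invariant vector field `Y`. -/
def lieDeriv {Γ : Subgroup G} (Y : lieAlgebra G) (φ : RightCosets Γ → ℂ) (x : RightCosets Γ) : ℂ :=
  deriv (fun t : ℝ => φ (MulOpposite.op (expG (t • Y)) • x)) 0

/-- The space `C_c^∞(Γ\X)`: functions on `Γ\G` that are smooth (in exponential coordinates
`Y ↦ x exp Y`, `Y ∈ 𝔤`), right `K`-invariant and compactly supported. -/
structure IsTestFunction (K Γ : Subgroup G) (φ : RightCosets Γ → ℂ) : Prop where
  smooth : ∀ (x : RightCosets Γ) (m : ℕ) (Y : Fin m → lieAlgebra G),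
    ContDiff ℝ ∞ (fun t : Fin m → ℝ => φ (MulOpposite.op (expG (∑ i, t i • Y i)) • x))
  invariant : ∀ k ∈ K, ∀ x, φ (MulOpposite.op k • x) = φ x
  compact : HasCompactSupport φ

/-- The Dirichlet form `∫_{Γ\X} ⟨grad φ, grad ψ⟩ dvol`; `e` is an orthonormal basis of `𝔭`. -/
def dirichletForm {Γ : Subgroup G} (μ : Measure G) {d : ℕ} (e : Fin d → lieAlgebra G)
    (φ ψ : RightCosets Γ → ℂ) : ℂ :=
  ∫ x, ∑ i, lieDeriv (e i) φ x * conj (lieDeriv (e i) ψ x) ∂(RightCosets.quotientMeasure Γ μ)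

/-- The Hilbert space `L²(Γ\X)`: the `K`-invariant vectors of `L²(Γ\G)`. -/
def L2X (K Γ : Subgroup G) (μ : Measure G) [μ.IsMulRightInvariant] :
    Submodule ℂ (Lp ℂ 2 (RightCosets.quotientMeasure Γ μ)) where
  carrier := {f | ∀ k ∈ K, rightRep G (RightCosets Γ) (RightCosets.quotientMeasure Γ μ) k f = f}
  add_mem' := by
    intro f h hf hh k hk
    rw [map_add, hf k hk, hh k hk]
  zero_mem' := fun k _ => map_zero _
  smul_mem' := by
    intro a f hf k hk
    rw [map_smul, hf k hk]

/-- The sequence `φ` in `C_c^∞(Γ\X)` is Cauchy for the norm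
`‖φ‖² = ∫ |φ|² + ∫ ‖grad φ‖²` of `W¹(Γ\X)` and has the limit `f` in `L²(Γ\X)`; so `f` belongs to
the closure `W¹(Γ\X)` of `C_c^∞(Γ\X)` and `φ` converges to `f` in `W¹(Γ\X)`. -/
structure TendstoW1 (K Γ : Subgroup G) (μ : Measure G) [μ.IsMulRightInvariant] {d : ℕ}
    (e : Fin d → lieAlgebra G) (φ : ℕ → RightCosets Γ → ℂ) (f : L2X K Γ μ) : Prop where
  test : ∀ m, IsTestFunction K Γ (φ m)
  tendsto : Tendsto (fun m => eLpNorm (fun x => φ m x - f.1 x) 2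
    (RightCosets.quotientMeasure Γ μ)) atTop (𝓝 0)
  cauchy : ∀ ε : ℝ, 0 < ε → ∃ N : ℕ, ∀ m ≥ N, ∀ m' ≥ N,
    ‖dirichletForm μ e (φ m - φ m') (φ m - φ m')‖ < ε

/-- `f` is in the domain of the self-adjoint operator `-Δ` on `L²(Γ\X)` and `-Δ f = h`. This is the
(Friedrichs) extension of `-Δ` on `C_c^∞(Γ\X)` with domain in `W¹(Γ\X)`: `f ∈ W¹(Γ\X)` and
`∫ ⟨grad f, grad ψ⟩ dvol = ∫ h ψ̄ dvol` for all `ψ ∈ C_c^∞(Γ\X)`. -/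
def NegLaplacian (K Γ : Subgroup G) (μ : Measure G) [μ.IsMulRightInvariant] {d : ℕ}
    (e : Fin d → lieAlgebra G) (f h : L2X K Γ μ) : Prop :=
  ∃ φ : ℕ → RightCosets Γ → ℂ, TendstoW1 K Γ μ e φ f ∧
    ∀ ψ : RightCosets Γ → ℂ, IsTestFunction K Γ ψ →
      Tendsto (fun m => dirichletForm μ e (φ m) ψ) atTop
        (𝓝 (∫ x, h.1 x * conj (ψ x) ∂(RightCosets.quotientMeasure Γ μ)))

/-- The `L²`-spectrum `σ(Γ\X)` of `-Δ`: all complex `z` for which `-Δ - z` has no bounded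
inverse. For `Γ` trivial this is `σ(X)`. -/
def laplaceSpectrum (K Γ : Subgroup G) (μ : Measure G) [μ.IsMulRightInvariant] {d : ℕ}
    (e : Fin d → lieAlgebra G) : Set ℂ :=
  {z | ¬ ∃ R : L2X K Γ μ →L[ℂ] L2X K Γ μ,
    (∀ h, NegLaplacian K Γ μ e (R h) (h + z • R h)) ∧
    ∀ f h, NegLaplacian K Γ μ e f h → R (h - z • f) = f}

end Laplace

end

noncomputable section

/-! A ball of `G` which embeds into `Γ\G` after a left translation carries compactly supported
functions from `G` to `Γ\G` without changing `L²` inner products or gradients. A large injectivity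
radius thus embeds every compactly supported piece of `L²(G)` isometrically and, on a given compact
set of group elements, equivariantly; as compactly supported functions are dense, this is weak
containment.

For the spectrum, `-Δ - z` has a bounded inverse if and only if its form
`∫ ⟨grad φ, grad ψ⟩ - z ∫ φ ψ̄` on test functions satisfies the inf-sup inequality
`c ‖φ‖ ≤ sup {|form(φ, ψ)| : ‖ψ‖ ≤ 1}` in the `W¹` norm. The inequality for `Γ\X` implies the one
for `X`: transplant `φ` from `X` to `Γ\X`, test it there against `ψ`, and bring `ψ` back to `X`
after multiplying it by a cutoff function which is `1` on the support of `φ`. The cutoff functions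
have gradients bounded independently of `φ`, so that `c` changes by a fixed factor only. -/

/-! ### The closed subgroup theorem in the unit group of a Banach algebra -/

section UnitExponential

variable {A : Type*} [NormedRing A] [NormedAlgebra ℝ A] [CompleteSpace A]

theorem contDiff_normedSpace_exp : ContDiff ℝ ∞ (NormedSpace.exp : A → A) :=
  contDiff_iff_contDiffAt.2 fun x => (NormedSpace.exp_analytic (𝕂 := ℝ) x).contDiffAt

theorem exists_contDiffAt_log : ∃ Λ : A → A, ContDiffAt ℝ ∞ Λ 1 ∧
    ∀ᶠ Z in 𝓝 (0 : A), Λ (NormedSpace.exp Z) = Z := by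
  have hexp : ContDiffAt ℝ ∞ (NormedSpace.exp : A → A) 0 := contDiff_normedSpace_exp.contDiffAt
  have hderiv : HasFDerivAt (NormedSpace.exp : A → A)
      ((ContinuousLinearEquiv.refl ℝ A : A ≃L[ℝ] A) : A →L[ℝ] A) 0 :=
    (hasStrictFDerivAt_exp_zero (𝕂 := ℝ)).hasFDerivAt
  have hn : (∞ : WithTop ℕ∞) ≠ 0 := by simp
  refine ⟨hexp.localInverse hderiv hn, by simpa using hexp.to_localInverse hderiv hn, ?_⟩
  exact (hexp.hasStrictFDerivAt' hderiv hn).eventually_left_inverse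

theorem isUnit_normedSpace_exp (Y : A) : IsUnit (NormedSpace.exp Y) :=
  let _ : NormedAlgebra ℚ A := NormedAlgebra.restrictScalars ℚ ℝ A
  NormedSpace.isUnit_exp Y

/-- The exponential map of a real Banach algebra with values in its unit group. For the algebra of
matrices this is `expGL`, definitionally. -/
def expUnit (Y : A) : Aˣ := (isUnit_normedSpace_exp Y).unit

theorem continuous_expUnit : Continuous (expUnit : A → Aˣ) :=
  Units.isOpenEmbedding_val.isEmbedding.continuous_iff.2 contDiff_normedSpace_exp.continuous

theorem expUnit_zero : expUnit (0 : A) = 1 := Units.ext NormedSpace.exp_zero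

theorem expUnit_add_of_commute {X Y : A} (h : Commute X Y) :
    expUnit (X + Y) = expUnit X * expUnit Y :=
  let _ : NormedAlgebra ℚ A := NormedAlgebra.restrictScalars ℚ ℝ A
  Units.ext (NormedSpace.exp_add_of_commute h)

theorem expUnit_nsmul (k : ℕ) (Y : A) : expUnit (k • Y) = expUnit Y ^ k :=
  let _ : NormedAlgebra ℚ A := NormedAlgebra.restrictScalars ℚ ℝ A
  Units.ext (NormedSpace.exp_nsmul k Y)

theorem expUnit_neg (Y : A) : expUnit (-Y) = (expUnit Y)⁻¹ := by
  rw [eq_inv_iff_mul_eq_one, ← expUnit_add_of_commute (Commute.refl Y).neg_left, neg_add_cancel,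
    expUnit_zero]

variable {H : Subgroup Aˣ}

theorem expUnit_smul_mem_of_tendsto_direction (hH : IsClosed (H : Set Aˣ)) {ι : Type*}
    {l : Filter ι} [l.NeBot] {Y : ι → A} {Z : A} (hY : ∀ k, expUnit (Y k) ∈ H)
    (hY0 : ∀ k, Y k ≠ 0) (hlim : Tendsto Y l (𝓝 0))
    (hZ : Tendsto (fun k => ‖Y k‖⁻¹ • Y k) l (𝓝 Z)) (t : ℝ) : expUnit (t • Z) ∈ H := by
  wlog ht : 0 ≤ t generalizing t
  · simpa [expUnit_neg] using H.inv_mem (this (-t) (by linarith))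
  have hpos : ∀ k, 0 < ‖Y k‖ := fun k => norm_pos_iff.2 (hY0 k)
  have hinv : Tendsto (fun k => ‖Y k‖⁻¹) l atTop :=
    (tendsto_nhdsWithin_iff.2 ⟨tendsto_norm_zero.comp hlim,
      Eventually.of_forall hpos⟩).inv_tendsto_nhdsGT_zero
  have hmul : Tendsto (fun k => (⌊t * ‖Y k‖⁻¹⌋₊ : ℝ) / ‖Y k‖⁻¹) l (𝓝 t) :=
    (tendsto_nat_floor_mul_div_atTop ht).comp hinv
  have hpow : Tendsto (fun k => expUnit (Y k) ^ ⌊t * ‖Y k‖⁻¹⌋₊) l (𝓝 (expUnit (t • Z))) := by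
    refine ((continuous_expUnit.tendsto _).comp (hmul.smul hZ)).congr fun k => ?_
    rw [Function.comp_apply, smul_smul, div_mul_cancel₀ _ (inv_pos.2 (hpos k)).ne',
      Nat.cast_smul_eq_nsmul, expUnit_nsmul]
  exact hH.mem_of_tendsto hpow (Eventually.of_forall fun k => pow_mem (hY k) _)

theorem map_expUnit_mul_expUnit_nhds_zero [FiniteDimensional ℝ A] {L M : Submodule ℝ A}
    (hLM : Codisjoint L M) :
    map (fun q : L × M => expUnit (q.1 : A) * expUnit (q.2 : A)) (𝓝 0) = 𝓝 1 := by
  have hexp : HasStrictFDerivAt (NormedSpace.exp : A → A) (1 : A →L[ℝ] A) 0 :=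
    hasStrictFDerivAt_exp_zero (𝕂 := ℝ)
  have hfst : HasStrictFDerivAt (fun q : L × M => NormedSpace.exp (q.1 : A))
      ((1 : A →L[ℝ] A).comp (L.subtypeL.comp (ContinuousLinearMap.fst ℝ L M))) 0 :=
    HasStrictFDerivAt.comp (f := fun q : L × M => (q.1 : A)) (0 : L × M) (by simpa using hexp)
      (L.subtypeL.comp (ContinuousLinearMap.fst ℝ L M)).hasStrictFDerivAt
  have hsnd : HasStrictFDerivAt (fun q : L × M => NormedSpace.exp (q.2 : A))
      ((1 : A →L[ℝ] A).comp (M.subtypeL.comp (ContinuousLinearMap.snd ℝ L M))) 0 :=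
    HasStrictFDerivAt.comp (f := fun q : L × M => (q.2 : A)) (0 : L × M) (by simpa using hexp)
      (M.subtypeL.comp (ContinuousLinearMap.snd ℝ L M)).hasStrictFDerivAt
  have hmul : HasStrictFDerivAt
      (fun q : L × M => NormedSpace.exp (q.1 : A) * NormedSpace.exp (q.2 : A))
      (L.subtypeL.coprod M.subtypeL) 0 := by
    refine (hfst.mul' hsnd).congr_fderiv ?_
    ext q <;> simp
  have hrange : (L.subtypeL.coprod M.subtypeL).range = ⊤ := by
    rw [ContinuousLinearMap.range_coprod]
    simpa using codisjoint_iff.1 hLM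
  apply Filter.map_injective Units.val_injective
  rw [Units.isOpenEmbedding_val.map_nhds_eq, Filter.map_map]
  simpa [Function.comp_def, expUnit] using hmul.map_nhds_eq_of_surj hrange

variable [FiniteDimensional ℝ A]

theorem eventually_eq_zero_of_expUnit_mem (hH : IsClosed (H : Set Aˣ)) {M : Submodule ℝ A}
    (hM : ∀ Y ∈ M, (∀ t : ℝ, expUnit (t • Y) ∈ H) → Y = 0) :
    ∀ᶠ Y in 𝓝 (0 : A), Y ∈ M → expUnit Y ∈ H → Y = 0 := by
  by_contra hcon
  rw [not_eventually] at hcon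
  obtain ⟨Y, hlim, hY⟩ := exists_seq_forall_of_frequently hcon
  simp only [Classical.not_imp] at hY
  have hsphere : ∀ k, ‖Y k‖⁻¹ • Y k ∈ Metric.sphere (0 : A) 1 := fun k => by
    simp [norm_smul, norm_ne_zero_iff.2 (hY k).2.2]
  have : ProperSpace A := FiniteDimensional.proper ℝ A
  obtain ⟨Z, hZ, ψ, hψ, hψZ⟩ := (isCompact_sphere (0 : A) 1).tendsto_subseq hsphere
  have hZM : Z ∈ M := (Submodule.closed_of_finiteDimensional M).mem_of_tendsto hψZ
    (Eventually.of_forall fun k => M.smul_mem _ (hY _).1)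
  have hZ0 : Z = 0 := hM Z hZM <|
    expUnit_smul_mem_of_tendsto_direction hH (Y := Y ∘ ψ) (fun k => (hY _).2.1)
      (fun k => (hY _).2.2) (hlim.comp hψ.tendsto_atTop) hψZ
  simp [hZ0] at hZ

variable {L : Submodule ℝ A}

theorem eventually_exists_mem_expUnit_eq (hH : IsClosed (H : Set Aˣ))
    (hL : ∀ Y, Y ∈ L ↔ ∀ t : ℝ, expUnit (t • Y) ∈ H) {O : Set A} (hO : O ∈ 𝓝 (0 : A)) :
    ∀ᶠ u in 𝓝 (1 : Aˣ), u ∈ H → ∃ X ∈ L, X ∈ O ∧ expUnit X = u := by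
  obtain ⟨M, hLM⟩ := L.exists_isCompl
  have hM : ∀ᶠ Y in 𝓝 (0 : A), Y ∈ M → expUnit Y ∈ H → Y = 0 :=
    eventually_eq_zero_of_expUnit_mem hH fun Y hYM hYH =>
      Submodule.disjoint_def.1 hLM.disjoint Y ((hL Y).2 hYH) hYM
  have hfst : Tendsto (fun q : L × M => (q.1 : A)) (𝓝 0) (𝓝 0) :=
    (continuous_subtype_val.comp continuous_fst).tendsto' _ _ rfl
  have hsnd : Tendsto (fun q : L × M => (q.2 : A)) (𝓝 0) (𝓝 0) :=
    (continuous_subtype_val.comp continuous_snd).tendsto' _ _ rfl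
  have himage := image_mem_map (m := fun q : L × M => expUnit (q.1 : A) * expUnit (q.2 : A))
    ((hfst.eventually hO).and (hsnd.eventually hM))
  rw [map_expUnit_mul_expUnit_nhds_zero hLM.codisjoint] at himage
  filter_upwards [himage]
  rintro _ ⟨⟨X, Y⟩, ⟨hXO, hY⟩, rfl⟩ huH
  have hXH : expUnit (X : A) ∈ H := by simpa using (hL X).1 X.2 1
  have hY0 : (Y : A) = 0 := hY Y.2 ((H.mul_mem_cancel_left hXH).1 huH)
  exact ⟨X, X.2, hXO, by simp [hY0, expUnit_zero]⟩

theorem exists_contDiffAt_expUnit_mul (hH : IsClosed (H : Set Aˣ))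
    (hL : ∀ Y, Y ∈ L ↔ ∀ t : ℝ, expUnit (t • Y) ∈ H)
    {ι : Type*} [Fintype ι] (b : Module.Basis ι ℝ L) {Y : A} (hY : Y ∈ L) :
    ∃ Θ : (ι → ℝ) × ℝ → (ι → ℝ), ContDiffAt ℝ ∞ Θ 0 ∧ ∀ᶠ p in 𝓝 (0 : (ι → ℝ) × ℝ),
      expUnit (∑ i, p.1 i • (b i : A)) * expUnit (p.2 • Y) =
        expUnit (∑ i, Θ p i • (b i : A)) := by
  obtain ⟨Λ, hΛ, hΛexp⟩ := exists_contDiffAt_log (A := A)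
  obtain ⟨P, hP⟩ := L.subtype.exists_leftInverse_of_injective L.ker_subtype
  let T : A →L[ℝ] (ι → ℝ) := LinearMap.toContinuousLinearMap (b.equivFun.toLinearMap ∘ₗ P)
  have hT : ∀ X ∈ L, ∑ i, T X i • (b i : A) = X := fun X hX => by
    have hPX : P X = ⟨X, hX⟩ := LinearMap.congr_fun hP ⟨X, hX⟩
    have hsum := congrArg L.subtype (b.sum_equivFun ⟨X, hX⟩)
    simp only [map_sum, map_smul, Submodule.subtype_apply] at hsum
    simpa only [T, LinearMap.coe_toContinuousLinearMap', LinearMap.coe_comp, Function.comp_apply,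
      LinearEquiv.coe_coe, hPX] using hsum
  let u : (ι → ℝ) × ℝ → Aˣ := fun p => expUnit (∑ i, p.1 i • (b i : A)) * expUnit (p.2 • Y)
  have hu : ContDiff ℝ ∞ fun p => (u p : A) :=
    (contDiff_normedSpace_exp.comp (by fun_prop)).mul (contDiff_normedSpace_exp.comp (by fun_prop))
  have hu0 : u 0 = 1 := by simp [u, expUnit_zero]
  have huH : ∀ p, u p ∈ H := fun p =>
    have hexp : ∀ X ∈ L, expUnit X ∈ H := fun X hX => by simpa using (hL X).1 hX 1
    H.mul_mem (hexp _ (L.sum_mem fun i _ => L.smul_mem _ (b i).2)) (hexp _ (L.smul_mem _ hY))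
  have hucont : Continuous u := Units.isOpenEmbedding_val.isEmbedding.continuous_iff.2 hu.continuous
  refine ⟨fun p => T (Λ (u p)), ?_, ?_⟩
  · refine T.contDiff.contDiffAt.comp _ (ContDiffAt.comp _ ?_ hu.contDiffAt)
    rwa [hu0]
  · filter_upwards [(hucont.tendsto' _ _ hu0).eventually
      (eventually_exists_mem_expUnit_eq hH hL hΛexp)] with p hp
    obtain ⟨X, hXL, hXΛ, hXu⟩ := hp (huH p)
    have hΛu : Λ (u p) = X := by rw [← hXu]; exact hXΛ
    change u p = _
    rw [hΛu, hT X hXL, hXu]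

end UnitExponential

/-! ### Closed linear groups -/

section ClosedLinearGroup

open scoped Matrix.Norms.Operator in
theorem isOpenEmbedding_val_GL (n : ℕ) :
    IsOpenEmbedding (Units.val : GL (Fin n) ℝ → Matrix (Fin n) (Fin n) ℝ) :=
  Units.isOpenEmbedding_val

instance instSecondCountableTopologyGL (n : ℕ) : SecondCountableTopology (GL (Fin n) ℝ) :=
  have : SecondCountableTopology (Matrix (Fin n) (Fin n) ℝ) :=
    inferInstanceAs (SecondCountableTopology (Fin n → Fin n → ℝ))
  (isOpenEmbedding_val_GL n).isEmbedding.secondCountableTopology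

instance instLocallyCompactSpaceGL (n : ℕ) : LocallyCompactSpace (GL (Fin n) ℝ) :=
  have : LocallyCompactSpace (Matrix (Fin n) (Fin n) ℝ) :=
    inferInstanceAs (LocallyCompactSpace (Fin n → Fin n → ℝ))
  (isOpenEmbedding_val_GL n).locallyCompactSpace

variable {n : ℕ} {G : ClosedSubgroup (GL (Fin n) ℝ)}

theorem isClosedEmbedding_val_closedSubgroup (G : ClosedSubgroup (GL (Fin n) ℝ)) :
    IsClosedEmbedding (Subtype.val : G → GL (Fin n) ℝ) :=
  IsClosed.isClosedEmbedding_subtypeVal G.isClosed'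

instance instSecondCountableTopologyClosedLinearGroup : SecondCountableTopology G :=
  (isClosedEmbedding_val_closedSubgroup G).isEmbedding.secondCountableTopology

instance instLocallyCompactSpaceClosedLinearGroup : LocallyCompactSpace G :=
  (isClosedEmbedding_val_closedSubgroup G).locallyCompactSpace

/-- The matrix of an element of a closed linear group. -/
abbrev toMatrix (g : G) : Matrix (Fin n) (Fin n) ℝ := ((g : GL (Fin n) ℝ) : Matrix _ _ ℝ)

theorem isEmbedding_toMatrix : IsEmbedding (toMatrix : G → Matrix (Fin n) (Fin n) ℝ) :=
  (isOpenEmbedding_val_GL n).isEmbedding.comp (isClosedEmbedding_val_closedSubgroup G).isEmbedding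

theorem toMatrix_mul (g h : G) : toMatrix (g * h) = toMatrix g * toMatrix h := rfl

theorem toMatrix_expG (Y : lieAlgebra G) :
    toMatrix (expG Y) = NormedSpace.exp (Y : Matrix (Fin n) (Fin n) ℝ) := rfl

theorem coe_sum_smul {ι : Type*} [Fintype ι] (c : ι → ℝ) (Y : ι → lieAlgebra G) :
    ((∑ i, c i • Y i : lieAlgebra G) : Matrix (Fin n) (Fin n) ℝ) =
      ∑ i, c i • (Y i : Matrix (Fin n) (Fin n) ℝ) :=
  map_sum (lieAlgebra G).toSubmodule.subtype (fun i => c i • Y i) Finset.univ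

open scoped Matrix.Norms.Operator in
theorem expG_zero : expG (0 : lieAlgebra G) = 1 := Subtype.ext expUnit_zero

open scoped Matrix.Norms.Operator in
theorem expG_neg (Y : lieAlgebra G) : expG (-Y) = (expG Y)⁻¹ :=
  Subtype.ext (expUnit_neg (Y : Matrix (Fin n) (Fin n) ℝ))

open scoped Matrix.Norms.Operator in
theorem continuous_expG : Continuous (expG : lieAlgebra G → G) :=
  (continuous_expUnit.comp continuous_subtype_val).subtype_mk _

open scoped Matrix.Norms.Operator in
theorem image_expG_mem_nhds_one {O : Set (lieAlgebra G)} (hO : O ∈ 𝓝 0) :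
    expG '' O ∈ 𝓝 (1 : G) := by
  obtain ⟨O', hO', hOO'⟩ := (mem_nhds_subtype _ _ _).1 hO
  have hexp := eventually_exists_mem_expUnit_eq (H := G.toSubgroup)
    (L := (lieAlgebra G).toSubmodule) G.isClosed' (fun _ => Iff.rfl) hO'
  filter_upwards [(continuous_subtype_val.tendsto' (1 : G) 1 rfl).eventually hexp] with g hg
  obtain ⟨X, hX, hXO, hXg⟩ := hg g.2
  exact ⟨⟨X, hX⟩, hOO' hXO, Subtype.ext hXg⟩

theorem map_expG_nhds_zero : map (expG : lieAlgebra G → G) (𝓝 0) = 𝓝 1 :=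
  le_antisymm (continuous_expG.tendsto' _ _ expG_zero) fun _ hs =>
    mem_of_superset (image_expG_mem_nhds_one hs) (Set.image_preimage_subset _ _)

open scoped Matrix.Norms.Operator in
theorem exists_contDiffAt_expG_mul {ι : Type*} [Fintype ι] (b : Module.Basis ι ℝ (lieAlgebra G))
    (Y : lieAlgebra G) :
    ∃ Θ : (ι → ℝ) × ℝ → (ι → ℝ), ContDiffAt ℝ ∞ Θ 0 ∧ ∀ᶠ p in 𝓝 (0 : (ι → ℝ) × ℝ),
      expG (∑ i, p.1 i • b i) * expG (p.2 • Y) = expG (∑ i, Θ p i • b i) := by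
  obtain ⟨Θ, hΘ, hmul⟩ := exists_contDiffAt_expUnit_mul (H := G.toSubgroup)
    (L := (lieAlgebra G).toSubmodule) G.isClosed' (fun _ => Iff.rfl) b Y.2
  refine ⟨Θ, hΘ, hmul.mono fun p hp => isEmbedding_toMatrix.injective ?_⟩
  rw [toMatrix_mul, toMatrix_expG, toMatrix_expG, toMatrix_expG, coe_sum_smul, coe_sum_smul]
  exact congrArg Units.val hp

open scoped Matrix.Norms.Operator in
theorem hasDerivAt_toMatrix_expG (Y : lieAlgebra G) (t : ℝ) (i j : Fin n) :
    HasDerivAt (fun s : ℝ => toMatrix (expG (s • Y)) i j)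
      ((toMatrix (expG (t • Y)) * (Y : Matrix (Fin n) (Fin n) ℝ)) i j) t :=
  (LinearMap.toContinuousLinearMap (Matrix.entryLinearMap ℝ ℝ i j)).hasFDerivAt.comp_hasDerivAt t
    (hasDerivAt_exp_smul_const (𝕂 := ℝ) (Y : Matrix (Fin n) (Fin n) ℝ) t)

open scoped Matrix.Norms.Operator in
theorem contDiff_toMatrix_mul_expG {ι : Type*} [Fintype ι] (Y : ι → lieAlgebra G) (g : G)
    (i j : Fin n) :
    ContDiff ℝ ∞ fun t : ι → ℝ => toMatrix (g * expG (∑ l, t l • Y l)) i j := by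
  have hexp : ContDiff ℝ ∞ fun t : ι → ℝ =>
      NormedSpace.exp (∑ l, t l • (Y l : Matrix (Fin n) (Fin n) ℝ)) :=
    contDiff_normedSpace_exp.comp (by fun_prop)
  simp only [toMatrix_mul, toMatrix_expG, coe_sum_smul]
  exact (LinearMap.toContinuousLinearMap (Matrix.entryLinearMap ℝ ℝ i j ∘ₗ
    LinearMap.mulLeft ℝ (toMatrix g))).contDiff.comp hexp

end ClosedLinearGroup
end

noncomputable section

/-! ### Bounded sets for the Riemannian distance -/

section Distance

variable {n : ℕ} {G : ClosedSubgroup (GL (Fin n) ℝ)}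

instance instLocallyCompactSpaceLieAlgebra : LocallyCompactSpace (lieAlgebra G) :=
  have : LocallyCompactSpace (Matrix (Fin n) (Fin n) ℝ) :=
    inferInstanceAs (LocallyCompactSpace (Fin n → Fin n → ℝ))
  (IsClosed.isClosedEmbedding_subtypeVal (Submodule.closed_of_finiteDimensional
    (lieAlgebra G).toSubmodule)).locallyCompactSpace

instance instIsTopologicalAddGroupLieAlgebra : IsTopologicalAddGroup (lieAlgebra G) :=
  inferInstanceAs (IsTopologicalAddGroup (lieAlgebra G).toSubmodule)

/-- The adjoint action of `g⁻¹` on the Lie algebra, `Y ↦ g⁻¹ Y g`: the velocity of `c` turns into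
that of `t ↦ c t * g` by this map. -/
def conjLie (g : G) (Y : lieAlgebra G) : lieAlgebra G :=
  ⟨toMatrix g⁻¹ * (Y : Matrix (Fin n) (Fin n) ℝ) * toMatrix g, by
    intro s
    have hY : expGL (s • (Y : Matrix (Fin n) (Fin n) ℝ)) ∈ G := Y.2 s
    have hconj : expGL (s • (toMatrix g⁻¹ * (Y : Matrix (Fin n) (Fin n) ℝ) * toMatrix g)) =
        (g : GL (Fin n) ℝ)⁻¹ * expGL (s • (Y : Matrix (Fin n) (Fin n) ℝ)) * g := by
      ext1
      rw [coe_expGL, ← smul_mul_assoc, ← mul_smul_comm]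
      exact Matrix.exp_units_conj' (g : GL (Fin n) ℝ) _
    rw [hconj]
    exact mul_mem (mul_mem (inv_mem g.2) hY) g.2⟩

theorem toMatrix_mul_conjLie (g : G) (Y : lieAlgebra G) :
    toMatrix g * (conjLie g Y : Matrix (Fin n) (Fin n) ℝ) =
      (Y : Matrix (Fin n) (Fin n) ℝ) * toMatrix g := by
  have hinv : toMatrix g * toMatrix g⁻¹ = 1 := by rw [← toMatrix_mul, mul_inv_cancel]; rfl
  rw [conjLie, ← mul_assoc, ← mul_assoc, hinv, one_mul]

theorem continuous_conjLie : Continuous fun p : G × lieAlgebra G => conjLie p.1 p.2 := by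
  have hmatrix : Continuous (toMatrix : G → Matrix (Fin n) (Fin n) ℝ) :=
    isEmbedding_toMatrix.continuous
  exact continuous_induced_rng.2 (((hmatrix.comp continuous_fst.inv).mul
    (continuous_subtype_val.comp continuous_snd)).mul (hmatrix.comp continuous_fst))

theorem isC1Curve_const (g : G) : IsC1Curve (fun _ => g) fun _ => 0 := by
  refine ⟨continuousOn_const, fun t _ i j => ?_⟩
  simpa using hasDerivWithinAt_const t (Set.Icc 0 1) (toMatrix g i j)

theorem IsC1Curve.const_mul {c : ℝ → G} {Y : ℝ → lieAlgebra G} (h : IsC1Curve c Y) (g : G) :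
    IsC1Curve (fun t => g * c t) Y := by
  refine ⟨h.1, fun t ht i j => ?_⟩
  have hsum := HasDerivWithinAt.fun_sum (u := Finset.univ) fun k _ =>
    (h.2 t ht k j).const_mul (toMatrix g i k)
  refine hsum.congr_deriv ?_
  rw [← Matrix.mul_apply, ← mul_assoc]
  rfl

theorem IsC1Curve.mul_expG {c : ℝ → G} {Y : ℝ → lieAlgebra G} (h : IsC1Curve c Y)
    (Z : lieAlgebra G) :
    IsC1Curve (fun t => c t * expG (t • Z)) (fun t => conjLie (expG (t • Z)) (Y t) + Z) := by
  have hexp : Continuous fun t : ℝ => expG (t • Z) :=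
    continuous_expG.comp (continuous_id.smul continuous_const)
  refine ⟨(continuous_conjLie.comp_continuousOn (hexp.continuousOn.prodMk h.1)).add
    continuousOn_const, fun t ht i j => ?_⟩
  have hsum := HasDerivWithinAt.fun_sum (u := Finset.univ) fun k _ =>
    (h.2 t ht i k).fun_mul (hasDerivAt_toMatrix_expG Z t k j).hasDerivWithinAt
  have hvelocity : toMatrix (c t) * toMatrix (expG (t • Z)) *
      ((conjLie (expG (t • Z)) (Y t) + Z : lieAlgebra G) : Matrix (Fin n) (Fin n) ℝ) =
      toMatrix (c t) * (Y t : Matrix (Fin n) (Fin n) ℝ) * toMatrix (expG (t • Z)) +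
        toMatrix (c t) * (toMatrix (expG (t • Z)) * (Z : Matrix (Fin n) (Fin n) ℝ)) := by
    rw [AddMemClass.coe_add, mul_add, mul_assoc, mul_assoc, toMatrix_mul_conjLie, ← mul_assoc]
  refine hsum.congr_deriv ?_
  simp only [Finset.sum_add_distrib, ← Matrix.mul_apply]
  exact (congrFun (congrFun hvelocity i) j).symm

/-- The endpoints of the `C¹` curves in `G` that start at `1` and have velocity in `C`. -/
def reachable (C : Set (lieAlgebra G)) : Set G :=
  {x | ∃ (c : ℝ → G) (Y : ℝ → lieAlgebra G), IsC1Curve c Y ∧ c 0 = 1 ∧ c 1 = x ∧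
    Set.MapsTo Y (Set.Icc 0 1) C}

theorem reachable_mono {C C' : Set (lieAlgebra G)} (h : C ⊆ C') : reachable C ⊆ reachable C' := by
  rintro x ⟨c, Y, hcY, h0, h1, hY⟩
  exact ⟨c, Y, hcY, h0, h1, hY.mono_right h⟩

theorem one_mem_reachable : (1 : G) ∈ reachable ({0} : Set (lieAlgebra G)) :=
  ⟨_, _, isC1Curve_const 1, rfl, rfl, fun _ _ => rfl⟩

theorem exists_isCompact_mul_expG_mem_reachable {C O : Set (lieAlgebra G)} (hC : IsCompact C)
    (hO : IsCompact O) :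
    ∃ C', IsCompact C' ∧ ∀ x ∈ reachable C, ∀ Z ∈ O, x * expG Z ∈ reachable C' := by
  let velocity : ℝ × lieAlgebra G × lieAlgebra G → lieAlgebra G :=
    fun p => conjLie (expG (p.1 • p.2.1)) p.2.2 + p.2.1
  have hvelocity : Continuous velocity :=
    (continuous_conjLie.comp ((continuous_expG.comp (by fun_prop)).prodMk (by fun_prop))).add
      (by fun_prop)
  refine ⟨velocity '' (Set.Icc 0 1 ×ˢ O ×ˢ C),
    (isCompact_Icc.prod (hO.prod hC)).image hvelocity, ?_⟩
  rintro x ⟨c, Y, hcY, h0, h1, hY⟩ Z hZ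
  exact ⟨_, _, hcY.mul_expG Z, by simp [h0, expG_zero], by simp [h1],
    fun t ht => ⟨(t, Z, Y t), ⟨ht, hZ, hY ht⟩, rfl⟩⟩

theorem exists_isCompact_eventually_mem_reachable [PreconnectedSpace G] (x : G) :
    ∃ C : Set (lieAlgebra G), IsCompact C ∧ ∀ᶠ y in 𝓝 x, y ∈ reachable C := by
  obtain ⟨O, hO, hO0⟩ := exists_compact_mem_nhds (0 : lieAlgebra G)
  have hexpO : expG '' O ∈ 𝓝 (1 : G) := image_expG_mem_nhds_one hO0
  let D : Set G := {x | ∃ C : Set (lieAlgebra G), IsCompact C ∧ x ∈ reachable C}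
  have hlocal : ∀ x ∈ D, ∃ C : Set (lieAlgebra G), IsCompact C ∧ ∀ᶠ y in 𝓝 x, y ∈ reachable C := by
    rintro x ⟨C, hC, hx⟩
    obtain ⟨C', hC', hCC'⟩ := exists_isCompact_mul_expG_mem_reachable hC hO
    have htendsto : Tendsto (fun y => x⁻¹ * y) (𝓝 x) (𝓝 1) :=
      (continuous_const_mul x⁻¹).tendsto' _ _ (inv_mul_cancel x)
    refine ⟨C', hC', (htendsto.eventually hexpO).mono ?_⟩
    rintro y ⟨Z, hZ, hZy⟩
    simpa [hZy] using hCC' x hx Z hZ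
  have hopen : IsOpen D := isOpen_iff_mem_nhds.2 fun x hx => by
    obtain ⟨C, hC, hev⟩ := hlocal x hx
    exact hev.mono fun y hy => ⟨C, hC, hy⟩
  have hclosed : IsClosed D := isClosed_of_closure_subset fun x hx => by
    have htendsto : Tendsto (fun z => z⁻¹ * x) (𝓝 x) (𝓝 1) :=
      (continuous_inv.mul continuous_const).tendsto' _ _ (inv_mul_cancel x)
    obtain ⟨z, ⟨Z, hZ, hZx⟩, C, hC, hz⟩ := mem_closure_iff_nhds.1 hx _ (htendsto hexpO)
    obtain ⟨C', hC', hCC'⟩ := exists_isCompact_mul_expG_mem_reachable hC hO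
    exact ⟨C', hC', by simpa [hZx] using hCC' z hz Z hZ⟩
  have huniv : D = Set.univ :=
    IsClopen.eq_univ ⟨hclosed, hopen⟩ ⟨1, {0}, isCompact_singleton, one_mem_reachable⟩
  exact hlocal x (huniv ▸ Set.mem_univ x)

theorem exists_isCompact_subset_reachable [PreconnectedSpace G] {Q : Set G} (hQ : IsCompact Q) :
    ∃ C : Set (lieAlgebra G), IsCompact C ∧ Q ⊆ reachable C := by
  refine hQ.induction_on (p := fun s => ∃ C : Set (lieAlgebra G), IsCompact C ∧ s ⊆ reachable C)
    ⟨∅, isCompact_empty, Set.empty_subset _⟩ ?_ ?_ ?_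
  · rintro s t hst ⟨C, hC, htC⟩
    exact ⟨C, hC, hst.trans htC⟩
  · rintro s t ⟨C, hC, hsC⟩ ⟨C', hC', htC'⟩
    exact ⟨C ∪ C', hC.union hC', Set.union_subset
      (hsC.trans (reachable_mono Set.subset_union_left))
      (htC'.trans (reachable_mono Set.subset_union_right))⟩
  · intro x _
    obtain ⟨C, hC, hev⟩ := exists_isCompact_eventually_mem_reachable x
    exact ⟨_, mem_nhdsWithin_of_mem_nhds hev, C, hC, fun _ hy => hy⟩

variable (θ : lieAlgebra G ≃ₗ⁅ℝ⁆ lieAlgebra G)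

theorem continuous_cartanNorm : Continuous (cartanNorm θ) := by
  have hlinear : ∀ T : lieAlgebra G →ₗ[ℝ] ℝ, Continuous T :=
    fun T => T.continuous_of_finiteDimensional
  let b := Module.finBasis ℝ (lieAlgebra G)
  have hexpand : ∀ Y, killingForm ℝ (lieAlgebra G) Y (θ Y) =
      ∑ i, b.coord i Y * killingForm ℝ (lieAlgebra G) (b i) (θ Y) := fun Y => by
    conv_lhs => rw [← b.sum_repr Y, map_sum, LinearMap.sum_apply, b.sum_repr]
    simp only [map_smul, LinearMap.smul_apply, smul_eq_mul, b.coord_apply]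
  refine Real.continuous_sqrt.comp (Continuous.neg ?_)
  simp only [hexpand]
  exact continuous_finsetSum _ fun i _ => (hlinear _).mul
    (hlinear (killingForm ℝ (lieAlgebra G) (b i) ∘ₗ θ.toLinearEquiv.toLinearMap))

theorem riemannianDist_mul_left_le (g x y : G) :
    riemannianDist θ (g * x) (g * y) ≤ riemannianDist θ x y :=
  le_iInf₂ fun c Y => le_iInf fun h => iInf₂_le_of_le (fun t => g * c t) Y <| iInf_le_of_le
    ⟨h.1.const_mul g, congrArg (g * ·) h.2.1, congrArg (g * ·) h.2.2⟩ le_rfl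

theorem exists_riemannianDist_le_of_isCompact [PreconnectedSpace G] {Q : Set G}
    (hQ : IsCompact Q) : ∃ r : ℝ≥0, ∀ x ∈ Q, riemannianDist θ x 1 ≤ r := by
  obtain ⟨C, hC, hQC⟩ := exists_isCompact_subset_reachable hQ.inv
  obtain ⟨M, hM⟩ := hC.exists_bound_of_continuousOn (continuous_cartanNorm θ).continuousOn
  refine ⟨M.toNNReal, fun x hx => ?_⟩
  obtain ⟨c, Y, hcY, h0, h1, hY⟩ := hQC (Set.inv_mem_inv.2 hx)
  refine iInf₂_le_of_le (fun t => x * c t) Y (iInf_le_of_le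
    ⟨hcY.const_mul x, by simp [h0], by simp [h1]⟩ (ENNReal.ofReal_le_ofReal ?_))
  have hint : ‖∫ t in (0 : ℝ)..1, cartanNorm θ (Y t)‖ ≤ M * |1 - 0| :=
    intervalIntegral.norm_integral_le_of_norm_le_const fun t ht => by
      rw [Set.uIoc_of_le zero_le_one] at ht
      exact hM _ (hY ⟨ht.1.le, ht.2⟩)
  simpa using (le_abs_self _).trans hint

variable {θ}

theorem exists_injOn_of_injRadius_eq_top [PreconnectedSpace G] {Γ : Subgroup G}
    (hinj : injRadius θ Γ = ⊤) {Q : Set G} (hQ : IsCompact Q) :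
    ∃ g : G, Set.InjOn (fun h => RightCosets.mk Γ (g * h)) Q := by
  obtain ⟨r, hr⟩ := exists_riemannianDist_le_of_isCompact θ hQ
  have hlt : (r : ℝ≥0∞) < injRadius θ Γ := hinj ▸ ENNReal.coe_lt_top
  simp only [injRadius, injRadiusAt, lt_iSup_iff] at hlt
  obtain ⟨g, R, hball, hrR⟩ := hlt
  have hmem : ∀ x ∈ Q, g * x ∈ {h : G | riemannianDist θ h g < R} := fun x hx =>
    calc riemannianDist θ (g * x) g = riemannianDist θ (g * x) (g * 1) := by rw [mul_one]
      _ ≤ riemannianDist θ x 1 := riemannianDist_mul_left_le θ g x 1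
      _ ≤ r := hr x hx
      _ < R := hrR
  exact ⟨g, fun x hx y hy hxy => mul_left_cancel (hball (hmem x hx) (hmem y hy) hxy)⟩

theorem IsConnectedSemisimpleRealAlgebraic.preconnectedSpace
    (hG : IsConnectedSemisimpleRealAlgebraic G) : PreconnectedSpace G := by
  obtain ⟨H, -, hH⟩ := hG.algebraic
  have hconn : IsPreconnected (G : Set (GL (Fin n) ℝ)) :=
    hH ▸ isPreconnected_connectedComponentIn
  exact isPreconnected_iff_preconnectedSpace.1 hconn

end Distance
end

noncomputable section

/-! ### Topology and measure of `Γ\G` -/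

namespace RightCosets

variable {G : Type*} [Group G] {Γ : Subgroup G}

theorem mk_surjective (Γ : Subgroup G) : Function.Surjective (mk Γ) := Quotient.mk_surjective

theorem mk_mul_of_mem {γ : G} (hγ : γ ∈ Γ) (x : G) : mk Γ (γ * x) = mk Γ x := by
  rw [mk_eq_mk, mul_inv_rev, mul_inv_cancel_left]
  exact inv_mem hγ

theorem exists_mul_eq_of_mk_eq {x y : G} (h : mk Γ x = mk Γ y) : ∃ γ ∈ Γ, γ * x = y :=
  ⟨y * x⁻¹, (mk_eq_mk Γ).1 h, inv_mul_cancel_right y x⟩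

/-- The map `h ↦ Γ g h`, the orbit map of the point `Γ g`. -/
def cosetMap (Γ : Subgroup G) (g h : G) : RightCosets Γ := mk Γ (g * h)

theorem op_smul_cosetMap (g h k : G) :
    MulOpposite.op k • cosetMap Γ g h = cosetMap Γ g (h * k) := by
  rw [cosetMap, op_smul_mk, mul_assoc]; rfl

theorem cosetMap_surjective (Γ : Subgroup G) (g : G) : Function.Surjective (cosetMap Γ g) :=
  (mk_surjective Γ).comp (mul_left_surjective g)

theorem cosetMap_bot_injective (g : G) : Function.Injective (cosetMap (⊥ : Subgroup G) g) := by
  intro x y h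
  have hmem : g * y * (g * x)⁻¹ ∈ (⊥ : Subgroup G) := (mk_eq_mk _).1 h
  exact (mul_left_cancel (mul_inv_eq_one.1 (Subgroup.mem_bot.1 hmem))).symm

/-- The function on `Γ\G` which is `f h` at `Γ g h` for `h ∈ U`, and vanishes off `Γ g U`. It is
meaningful if `h ↦ Γ g h` is injective on `U`. -/
def pushFun (Γ : Subgroup G) (g : G) (U : Set G) (f : G → ℂ) : RightCosets Γ → ℂ :=
  Function.extend (fun h : U => cosetMap Γ g h) (fun h => f h) 0

section PushFun

variable {g : G} {U : Set G} {f : G → ℂ}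

theorem pushFun_cosetMap (hU : Set.InjOn (cosetMap Γ g) U) {h : G} (hh : h ∈ U) :
    pushFun Γ g U f (cosetMap Γ g h) = f h :=
  Function.Injective.extend_apply (g := fun h : U => f h) (Set.injOn_iff_injective.1 hU) 0 ⟨h, hh⟩

theorem pushFun_eq_zero {x : RightCosets Γ} (hx : x ∉ cosetMap Γ g '' U) :
    pushFun Γ g U f x = 0 :=
  Function.extend_apply' _ _ _ fun ⟨h, hh⟩ => hx ⟨h, h.2, hh⟩

theorem support_pushFun_subset (hU : Set.InjOn (cosetMap Γ g) U) :
    Function.support (pushFun Γ g U f) ⊆ cosetMap Γ g '' (U ∩ Function.support f) := by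
  intro x hx
  obtain ⟨h, hh, rfl⟩ : x ∈ cosetMap Γ g '' U := by
    by_contra hxU
    exact hx (pushFun_eq_zero hxU)
  rw [Function.mem_support, pushFun_cosetMap hU hh] at hx
  exact ⟨h, ⟨hh, hx⟩, rfl⟩

end PushFun

theorem map_restrict_le_quotientMeasure [TopologicalSpace G] [MeasurableSpace G] (μ : Measure G)
    {U : Set G} (hUo : IsOpen U) (hU : Set.InjOn (mk Γ) U) :
    (μ.restrict U).map (mk Γ) ≤ quotientMeasure Γ μ :=
  le_iSup₂_of_le (f := fun (V : Set G) (_ : IsOpen V ∧ Set.InjOn (mk Γ) V) =>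
    (μ.restrict V).map (mk Γ)) U ⟨hUo, hU⟩ le_rfl

section Topology

variable [TopologicalSpace G] [IsTopologicalGroup G]

theorem isOpenMap_mk (Γ : Subgroup G) : IsOpenMap (mk Γ) := by
  intro U hU
  have hsaturation : mk Γ ⁻¹' (mk Γ '' U) = ⋃ γ : Γ, (fun x => (γ : G) * x) ⁻¹' U := by
    ext x
    simp only [Set.mem_preimage, Set.mem_image, Set.mem_iUnion]
    constructor
    · rintro ⟨y, hy, hxy⟩
      obtain ⟨γ, hγ, rfl⟩ := exists_mul_eq_of_mk_eq hxy.symm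
      exact ⟨⟨γ, hγ⟩, hy⟩
    · rintro ⟨γ, hγ⟩
      exact ⟨_, hγ, mk_mul_of_mem γ.2 x⟩
  change IsOpen (mk Γ ⁻¹' (mk Γ '' U))
  rw [hsaturation]
  exact isOpen_iUnion fun γ => hU.preimage (continuous_const_mul (γ : G))

theorem continuous_cosetMap (Γ : Subgroup G) (g : G) : Continuous (cosetMap Γ g) :=
  (continuous_mk Γ).comp (continuous_const_mul g)

theorem isOpenMap_cosetMap (Γ : Subgroup G) (g : G) : IsOpenMap (cosetMap Γ g) :=
  (isOpenMap_mk Γ).comp (isOpenMap_mul_left g)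

theorem map_nhds_cosetMap (Γ : Subgroup G) (g h : G) :
    map (cosetMap Γ g) (𝓝 h) = 𝓝 (cosetMap Γ g h) :=
  le_antisymm (continuous_cosetMap Γ g).continuousAt ((isOpenMap_cosetMap Γ g).nhds_le h)

instance instT2Space [T2Space G] [DiscreteTopology Γ] : T2Space (RightCosets Γ) := by
  have hdiff : Continuous fun p : G × G => p.2 * p.1⁻¹ := continuous_snd.mul continuous_fst.inv
  have hΓ : IsClosed (Γ : Set G) := Subgroup.isClosed_of_discrete
  refine (t2Space_iff_of_isOpenQuotientMap
    ⟨mk_surjective Γ, continuous_mk Γ, isOpenMap_mk Γ⟩).2 ?_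
  simp only [mk_eq_mk]
  exact hΓ.preimage hdiff

theorem exists_isOpen_injOn_mk (Γ : Subgroup G) [DiscreteTopology Γ] (g : G) :
    ∃ U : Set G, IsOpen U ∧ g ∈ U ∧ Set.InjOn (mk Γ) U := by
  obtain ⟨W, hW, hWΓ⟩ := (mem_nhds_subtype _ _ _).1
    ((isOpen_discrete ({1} : Set Γ)).mem_nhds (Set.mem_singleton 1))
  have hdiff : Continuous fun p : G × G => p.2 * p.1⁻¹ := continuous_snd.mul continuous_fst.inv
  have hev : ∀ᶠ p in 𝓝 g ×ˢ 𝓝 g, p.2 * p.1⁻¹ ∈ W :=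
    nhds_prod_eq (x := g) (y := g) ▸ (hdiff.tendsto' (g, g) 1 (mul_inv_cancel g)).eventually hW
  obtain ⟨s, hs, hsW⟩ := mem_prod_same_iff.1 hev
  obtain ⟨U, hUs, hUo, hgU⟩ := mem_nhds_iff.1 hs
  refine ⟨U, hUo, hgU, fun a ha b hb hab => ?_⟩
  have hmem : b * a⁻¹ ∈ Γ := (mk_eq_mk Γ).1 hab
  have hone : (⟨b * a⁻¹, hmem⟩ : Γ) = 1 := hWΓ (hsW (Set.mk_mem_prod (hUs ha) (hUs hb)))
  exact (mul_inv_eq_one.1 (congrArg Subtype.val hone)).symm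

section PushFun

variable [T2Space G] [DiscreteTopology Γ] {g : G} {U : Set G} {f : G → ℂ}

theorem tsupport_pushFun_subset (hU : Set.InjOn (cosetMap Γ g) U) (hf : HasCompactSupport f) :
    tsupport (pushFun Γ g U f) ⊆ cosetMap Γ g '' tsupport f :=
  closure_minimal ((support_pushFun_subset hU).trans
    (Set.image_mono (Set.inter_subset_right.trans (subset_tsupport f))))
    (hf.isCompact.image (continuous_cosetMap Γ g)).isClosed

theorem hasCompactSupport_pushFun (hU : Set.InjOn (cosetMap Γ g) U) (hf : HasCompactSupport f) :
    HasCompactSupport (pushFun Γ g U f) :=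
  (hf.isCompact.image (continuous_cosetMap Γ g)).of_isClosed_subset (isClosed_tsupport _)
    (tsupport_pushFun_subset hU hf)

theorem continuous_pushFun (hUo : IsOpen U) (hU : Set.InjOn (cosetMap Γ g) U)
    (hf : HasCompactSupport f) (hfU : tsupport f ⊆ U) (hfc : Continuous f) :
    Continuous (pushFun Γ g U f) := by
  refine continuous_of_tsupport fun x hx => ?_
  obtain ⟨h, hh, rfl⟩ := tsupport_pushFun_subset hU hf hx
  rw [ContinuousAt, ← map_nhds_cosetMap, tendsto_map'_iff, pushFun_cosetMap hU (hfU hh)]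
  refine (hfc.tendsto h).congr' ?_
  filter_upwards [hUo.mem_nhds (hfU hh)] with y hy
  exact (pushFun_cosetMap hU hy).symm

end PushFun

variable [MeasurableSpace G] [BorelSpace G]
  [SecondCountableTopology G] [DiscreteTopology Γ] (μ : Measure G) [μ.IsMulLeftInvariant]

theorem measure_preimage_mk_inter_le {U V : Set G} (hUm : MeasurableSet U) (hVm : MeasurableSet V)
    (hV : Set.InjOn (mk Γ) V) {E : Set (RightCosets Γ)} (hE : MeasurableSet E)
    (hEU : E ⊆ mk Γ '' U) : μ (mk Γ ⁻¹' E ∩ V) ≤ μ (mk Γ ⁻¹' E ∩ U) := by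
  have : Countable Γ := countable_of_Lindelof_of_discrete
  let piece : Γ → Set G := fun γ => mk Γ ⁻¹' E ∩ V ∩ (fun x => (γ : G)⁻¹ * x) ⁻¹' U
  let translate : Γ → Set G := fun γ => (fun x => (γ : G) * x) ⁻¹' piece γ
  have htranslate : ∀ γ, MeasurableSet (translate γ) := fun γ =>
    (continuous_const_mul (γ : G)).measurable <|
      (((continuous_mk Γ).measurable hE).inter hVm).inter
        ((continuous_const_mul (γ : G)⁻¹).measurable hUm)
  have hcover : mk Γ ⁻¹' E ∩ V ⊆ ⋃ γ, piece γ := by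
    rintro x ⟨hxE, hxV⟩
    obtain ⟨u, hu, hux⟩ := hEU hxE
    obtain ⟨γ, hγ, rfl⟩ := exists_mul_eq_of_mk_eq hux
    exact Set.mem_iUnion.2 ⟨⟨γ, hγ⟩, ⟨hxE, hxV⟩, by simpa using hu⟩
  have hdisjoint : Pairwise (Function.onFun Disjoint translate) := by
    intro γ γ' hne
    rw [Function.onFun, Set.disjoint_left]
    rintro x ⟨⟨-, hx⟩, -⟩ ⟨⟨-, hx'⟩, -⟩
    have heq : (γ : G) * x = γ' * x :=
      hV hx hx' (by rw [mk_mul_of_mem γ.2, mk_mul_of_mem γ'.2])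
    exact hne (Subtype.ext (mul_right_cancel heq))
  have hsubset : ⋃ γ, translate γ ⊆ mk Γ ⁻¹' E ∩ U := by
    refine Set.iUnion_subset fun γ => ?_
    rintro x ⟨⟨hxE, -⟩, hxU⟩
    rw [Set.mem_preimage, mk_mul_of_mem γ.2] at hxE
    exact ⟨hxE, by simpa using hxU⟩
  calc μ (mk Γ ⁻¹' E ∩ V) ≤ ∑' γ, μ (piece γ) := (measure_mono hcover).trans (measure_iUnion_le _)
    _ = ∑' γ, μ (translate γ) := by simp only [translate, measure_preimage_mul]
    _ = μ (⋃ γ, translate γ) := (measure_iUnion hdisjoint htranslate).symm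
    _ ≤ μ (mk Γ ⁻¹' E ∩ U) := measure_mono hsubset

theorem quotientMeasure_le_add_restrict_compl {U : Set G} (hUo : IsOpen U) :
    quotientMeasure Γ μ ≤
      (μ.restrict U).map (mk Γ) + (quotientMeasure Γ μ).restrict (mk Γ '' U)ᶜ := by
  have hmk : Measurable (mk Γ) := (continuous_mk Γ).measurable
  have himage : MeasurableSet (mk Γ '' U) := (isOpenMap_mk Γ U hUo).measurableSet
  refine iSup₂_le fun V ⟨hVo, hV⟩ => Measure.le_iff.2 fun E hE => ?_
  rw [← measure_inter_add_sdiff E himage, Measure.add_apply, Measure.restrict_apply hE]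
  refine add_le_add ?_ (map_restrict_le_quotientMeasure μ hVo hV _)
  have hEU : MeasurableSet (E ∩ mk Γ '' U) := hE.inter himage
  rw [Measure.map_apply hmk hEU, Measure.restrict_apply (hmk hEU), Measure.map_apply hmk hE,
    Measure.restrict_apply (hmk hE)]
  exact (measure_preimage_mk_inter_le μ hUo.measurableSet hVo.measurableSet hV hEU
    Set.inter_subset_right).trans
    (measure_mono (Set.inter_subset_inter_left _ (Set.preimage_mono Set.inter_subset_left)))

theorem restrict_image_mk_quotientMeasure {U : Set G} (hUo : IsOpen U)
    (hU : Set.InjOn (mk Γ) U) :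
    (quotientMeasure Γ μ).restrict (mk Γ '' U) = (μ.restrict U).map (mk Γ) := by
  have hmk : Measurable (mk Γ) := (continuous_mk Γ).measurable
  have himage : MeasurableSet (mk Γ '' U) := (isOpenMap_mk Γ U hUo).measurableSet
  have hsupp : ((μ.restrict U).map (mk Γ)).restrict (mk Γ '' U) = (μ.restrict U).map (mk Γ) := by
    rw [Measure.restrict_map hmk himage, Measure.restrict_restrict (hmk himage),
      Set.inter_eq_self_of_subset_right (Set.subset_preimage_image _ _)]
  refine le_antisymm ?_ ?_
  · refine (Measure.restrict_mono le_rfl (quotientMeasure_le_add_restrict_compl μ hUo)).trans ?_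
    rw [Measure.restrict_add, hsupp, Measure.restrict_restrict himage, Set.inter_compl_self,
      Measure.restrict_empty, add_zero]
  · rw [← hsupp]
    exact Measure.restrict_mono le_rfl (map_restrict_le_quotientMeasure μ hUo hU)

theorem restrict_image_cosetMap_quotientMeasure {g : G} {U : Set G} (hUo : IsOpen U)
    (hU : Set.InjOn (cosetMap Γ g) U) :
    (quotientMeasure Γ μ).restrict (cosetMap Γ g '' U) = (μ.restrict U).map (cosetMap Γ g) := by
  have hgUo : IsOpen ((g * ·) '' U) := isOpenMap_mul_left g U hUo
  have hgU : Set.InjOn (mk Γ) ((g * ·) '' U) := by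
    rintro _ ⟨a, ha, rfl⟩ _ ⟨b, hb, rfl⟩ hab
    exact congrArg (g * ·) (hU ha hb hab)
  have htranslate : μ.restrict ((g * ·) '' U) = (μ.restrict U).map (g * ·) := by
    have hrestrict := Measure.restrict_map (μ := μ) (continuous_const_mul g).measurable
      hgUo.measurableSet
    rwa [map_mul_left_eq_self, Set.preimage_image_eq _ (mul_right_injective g)] at hrestrict
  calc (quotientMeasure Γ μ).restrict (cosetMap Γ g '' U)
      = (quotientMeasure Γ μ).restrict (mk Γ '' ((g * ·) '' U)) := by rw [Set.image_image]; rfl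
    _ = ((μ.restrict U).map (g * ·)).map (mk Γ) := by
        rw [restrict_image_mk_quotientMeasure μ hgUo hgU, htranslate]
    _ = (μ.restrict U).map (cosetMap Γ g) :=
        Measure.map_map (continuous_mk Γ).measurable (continuous_const_mul g).measurable

section Integral

variable {g : G} {U : Set G} (hUo : IsOpen U) (hU : Set.InjOn (cosetMap Γ g) U)
  {E : Type*} [NormedAddCommGroup E] [NormedSpace ℝ E] [SecondCountableTopology E]
  {Φ : RightCosets Γ → E} (hΦ : Continuous Φ)

include hUo hU hΦ

theorem setIntegral_image_cosetMap :
    ∫ x in cosetMap Γ g '' U, Φ x ∂(quotientMeasure Γ μ) = ∫ h in U, Φ (cosetMap Γ g h) ∂μ := by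
  rw [restrict_image_cosetMap_quotientMeasure μ hUo hU,
    integral_map (continuous_cosetMap Γ g).aemeasurable hΦ.aestronglyMeasurable]

theorem integral_eq_setIntegral_cosetMap (hsupp : ∀ x ∉ cosetMap Γ g '' U, Φ x = 0) :
    ∫ x, Φ x ∂(quotientMeasure Γ μ) = ∫ h in U, Φ (cosetMap Γ g h) ∂μ := by
  rw [← setIntegral_image_cosetMap μ hUo hU hΦ,
    setIntegral_eq_integral_of_forall_compl_eq_zero hsupp]

end Integral

instance instIsFiniteMeasureOnCompactsQuotientMeasure [LocallyCompactSpace G]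
    [IsFiniteMeasureOnCompacts μ] : IsFiniteMeasureOnCompacts (quotientMeasure Γ μ) where
  lt_top_of_isCompact := by
    intro C hC
    refine hC.induction_on (p := fun s => quotientMeasure Γ μ s < ⊤) (by simp)
      (fun s t hst ht => (measure_mono hst).trans_lt ht)
      (fun s t hs ht => (measure_union_le s t).trans_lt (ENNReal.add_lt_top.2 ⟨hs, ht⟩)) ?_
    intro x _
    obtain ⟨g, rfl⟩ := mk_surjective Γ x
    obtain ⟨U, hUo, hgU, hU⟩ := exists_isOpen_injOn_mk Γ g
    obtain ⟨Q, hQ, hgQ, hQU⟩ := exists_compact_subset hUo hgU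
    have himage : IsOpen (mk Γ '' interior Q) := isOpenMap_mk Γ _ isOpen_interior
    refine ⟨_, mem_nhdsWithin_of_mem_nhds (himage.mem_nhds ⟨g, hgQ, rfl⟩), ?_⟩
    rw [← Measure.restrict_apply_self, restrict_image_mk_quotientMeasure μ isOpen_interior
      (hU.mono (interior_subset.trans hQU)), Measure.map_apply (continuous_mk Γ).measurable
      himage.measurableSet]
    calc μ.restrict (interior Q) _ ≤ μ.restrict (interior Q) Set.univ :=
          measure_mono (Set.subset_univ _)
      _ = μ (interior Q) := Measure.restrict_apply_univ _
      _ ≤ μ Q := measure_mono interior_subset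
      _ < ⊤ := hQ.measure_lt_top

end Topology

end RightCosets
end

noncomputable section

/-! ### Weak containment of the regular representation -/

theorem inner_toLp_toLp {Ω : Type*} [MeasurableSpace Ω] {ν : Measure Ω} {f g : Ω → ℂ}
    (hf : MemLp f 2 ν) (hg : MemLp g 2 ν) :
    inner ℂ (hf.toLp f) (hg.toLp g) = ∫ x, conj (f x) * g x ∂ν := by
  rw [L2.inner_def]
  refine integral_congr_ae ?_
  filter_upwards [hf.coeFn_toLp, hg.coeFn_toLp] with x hfx hgx
  rw [hfx, hgx, RCLike.inner_apply, mul_comm]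

section RightRep

variable {G Ω : Type*} [Group G] [MulAction Gᵐᵒᵖ Ω] [MeasurableSpace Ω]
  [MeasurableConstSMul Gᵐᵒᵖ Ω] {ν : Measure Ω} [SMulInvariantMeasure Gᵐᵒᵖ Ω ν]

theorem rightRep_toLp (g : G) {f : Ω → ℂ} (hf : MemLp f 2 ν) :
    rightRep G Ω ν g (hf.toLp f) =
      (hf.comp_measurePreserving (measurePreserving_smul (MulOpposite.op g) ν)).toLp
        (fun x => f (MulOpposite.op g • x)) := rfl

theorem inner_rightRep_toLp (g : G) {f : Ω → ℂ} (hf : MemLp f 2 ν) :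
    inner ℂ (hf.toLp f) (rightRep G Ω ν g (hf.toLp f)) =
      ∫ x, conj (f x) * f (MulOpposite.op g • x) ∂ν := by
  rw [rightRep_toLp, inner_toLp_toLp]

end RightRep

theorem norm_inner_map_sub_inner_map_le {V : Type*} [NormedAddCommGroup V] [InnerProductSpace ℂ V]
    (T : V ≃ₗᵢ[ℂ] V) (v w : V) :
    ‖inner ℂ v (T v) - inner ℂ w (T w)‖ ≤ ‖v - w‖ * (‖v‖ + ‖w‖) :=
  calc ‖inner ℂ v (T v) - inner ℂ w (T w)‖
      = ‖inner ℂ (v - w) (T v) + inner ℂ w (T (v - w))‖ := by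
        rw [map_sub, inner_sub_left, inner_sub_right, sub_add_sub_cancel]
    _ ≤ ‖v - w‖ * ‖T v‖ + ‖w‖ * ‖T (v - w)‖ :=
        norm_add_le_of_le (norm_inner_le_norm _ _) (norm_inner_le_norm _ _)
    _ = ‖v - w‖ * (‖v‖ + ‖w‖) := by rw [T.norm_map, T.norm_map]; ring

theorem weaklyContained_of_dense {G V W : Type*} [Group G] [TopologicalSpace G]
    [NormedAddCommGroup V] [InnerProductSpace ℂ V] [NormedAddCommGroup W] [InnerProductSpace ℂ W]
    {π : G →* (V ≃ₗᵢ[ℂ] V)} {σ : G →* (W ≃ₗᵢ[ℂ] W)} {D : Set V} (hD : Dense D)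
    (hcoeff : ∀ v ∈ D, ∀ Q : Set G, IsCompact Q →
      ∃ w : W, ∀ g ∈ Q, inner ℂ w (σ g w) = inner ℂ v (π g v)) :
    WeaklyContained π σ := by
  intro v Q hQ ε hε
  have hopen : IsOpen {u : V | ‖v - u‖ * (‖v‖ + ‖u‖) < ε} := isOpen_lt (by fun_prop) (by fun_prop)
  obtain ⟨u, hu, huD⟩ := hD.inter_open_nonempty _ hopen ⟨v, by simpa using hε⟩
  obtain ⟨w, hw⟩ := hcoeff u huD Q hQ
  refine ⟨1, fun _ => 1, fun _ => w, fun _ => zero_le_one, by simp, fun g hg => ?_⟩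
  simp only [Fin.sum_univ_one, Complex.ofReal_one, one_mul, hw g hg]
  exact (norm_inner_map_sub_inner_map_le (π g) v u).trans_lt hu

theorem dense_toLp_hasCompactSupport {X E : Type*} [TopologicalSpace X] [NormalSpace X]
    [R1Space X] [WeaklyLocallyCompactSpace X] [MeasurableSpace X] [BorelSpace X]
    [NormedAddCommGroup E] [NormedSpace ℝ E] {p : ℝ≥0∞} [Fact (1 ≤ p)] (hp : p ≠ ⊤)
    (μ : Measure X) [μ.Regular] :
    Dense {v : Lp E p μ | ∃ (f : X → E) (hf : MemLp f p μ),
      Continuous f ∧ HasCompactSupport f ∧ hf.toLp f = v} := by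
  rw [EMetric.dense_iff]
  intro v ε hε
  obtain ⟨δ, hδ, hδε⟩ := exists_between hε
  obtain ⟨f, hfs, hvf, hfc, hf⟩ :=
    (Lp.memLp v).exists_hasCompactSupport_eLpNorm_sub_le hp hδ.ne'
  refine ⟨hf.toLp f, ?_, f, hf, hfc, hfs, rfl⟩
  rw [Metric.mem_eball, edist_comm]
  nth_rewrite 1 [← Lp.toLp_coeFn v (Lp.memLp v)]
  rw [Lp.edist_toLp_toLp]
  exact hvf.trans_lt hδε

namespace RightCosets

variable {G : Type*} [Group G] [TopologicalSpace G] [IsTopologicalGroup G]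
  [SecondCountableTopology G] [MeasurableSpace G] [BorelSpace G]

theorem inner_rightRep_pushFun (μ : Measure G) [μ.IsMulLeftInvariant] [μ.IsMulRightInvariant]
    {Γ : Subgroup G} [DiscreteTopology Γ] {g q : G} {U : Set G} (hUo : IsOpen U)
    (hU : Set.InjOn (cosetMap Γ g) U) {f : G → ℂ} (hf : MemLp f 2 μ)
    (hpush : MemLp (pushFun Γ g U f) 2 (quotientMeasure Γ μ)) (hcont : Continuous (pushFun Γ g U f))
    (hfU : ∀ h, f h ≠ 0 → h ∈ U ∧ h * q ∈ U) :
    inner ℂ (hpush.toLp _)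
        (rightRep G (RightCosets Γ) (quotientMeasure Γ μ) q (hpush.toLp _)) =
      inner ℂ (hf.toLp f) (rightRep G G μ q (hf.toLp f)) := by
  have hpoint : ∀ h ∈ U, conj (pushFun Γ g U f (cosetMap Γ g h)) *
      pushFun Γ g U f (MulOpposite.op q • cosetMap Γ g h) = conj (f h) * f (h * q) := by
    intro h hh
    rw [pushFun_cosetMap hU hh, op_smul_cosetMap]
    by_cases hfh : f h = 0
    · simp only [hfh, map_zero, zero_mul]
    · rw [pushFun_cosetMap hU (hfU h hfh).2]
  have hzero : ∀ h ∉ U, conj (f h) * f (MulOpposite.op q • h) = 0 := fun h hh => by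
    rw [not_imp_comm.1 (fun hfh => (hfU h hfh).1) hh, map_zero, zero_mul]
  have hcoeff_cont : Continuous fun x : RightCosets Γ =>
      conj (pushFun Γ g U f x) * pushFun Γ g U f (MulOpposite.op q • x) :=
    (Complex.continuous_conj.comp hcont).mul (hcont.comp (continuous_const_smul _))
  rw [inner_rightRep_toLp, inner_rightRep_toLp, integral_eq_setIntegral_cosetMap μ hUo hU
    hcoeff_cont fun x hx => by rw [pushFun_eq_zero hx, map_zero, zero_mul],
    ← setIntegral_eq_integral_of_forall_compl_eq_zero hzero]
  exact setIntegral_congr_fun hUo.measurableSet hpoint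

theorem weaklyContained_of_exists_injOn [T2Space G] [LocallyCompactSpace G] (μ : Measure G)
    [μ.IsHaarMeasure] [μ.IsMulRightInvariant] (Γ : Subgroup G) [DiscreteTopology Γ]
    (hinj : ∀ Q : Set G, IsCompact Q → ∃ g : G, Set.InjOn (cosetMap Γ g) Q) :
    WeaklyContained (rightRep G G μ) (rightRep G (RightCosets Γ) (quotientMeasure Γ μ)) := by
  refine weaklyContained_of_dense (dense_toLp_hasCompactSupport (by simp) μ) ?_
  rintro _ ⟨f, hf, hfc, hfs, rfl⟩ Q hQ
  obtain ⟨C, hC, hsuppC⟩ := exists_compact_superset (hfs.isCompact.union (hfs.isCompact.mul hQ))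
  obtain ⟨g, hg⟩ := hinj C hC
  have hU : Set.InjOn (cosetMap Γ g) (interior C) := hg.mono interior_subset
  have hcont : Continuous (pushFun Γ g (interior C) f) :=
    continuous_pushFun isOpen_interior hU hfs (Set.subset_union_left.trans hsuppC) hfc
  have hpush : MemLp (pushFun Γ g (interior C) f) 2 (quotientMeasure Γ μ) :=
    hcont.memLp_of_hasCompactSupport (hasCompactSupport_pushFun hU hfs)
  exact ⟨hpush.toLp _, fun q hq => inner_rightRep_pushFun μ isOpen_interior hU hf hpush hcont
    fun h hh => ⟨hsuppC (Or.inl (subset_tsupport f hh)),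
      hsuppC (Or.inr (Set.mul_mem_mul (subset_tsupport f hh) hq))⟩⟩

end RightCosets

/-! ### The spectrum of the operator defined by a quadratic form -/

section Operators

variable {X Y : Type*}

theorem isUnit_one_sub_comp_comm [NormedAddCommGroup X] [NormedSpace ℂ X]
    [NormedAddCommGroup Y] [NormedSpace ℂ Y] {S : X →L[ℂ] Y} {T : Y →L[ℂ] X}
    (h : IsUnit (1 - S ∘L T)) : IsUnit (1 - T ∘L S) := by
  obtain ⟨R, hright, hleft⟩ := isUnit_iff_exists.1 h
  replace hright (y : Y) : R y - S (T (R y)) = y := congr($hright y)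
  replace hleft (y : Y) : R (y - S (T y)) = y := congr($hleft y)
  -- The inverse of `1 - TS` is `1 + T (1 - ST)⁻¹ S`.
  refine isUnit_iff_exists.2 ⟨1 + T ∘L R ∘L S, ?_, ?_⟩ <;> ext x
  · change x + T (R (S x)) - T (S (x + T (R (S x)))) = x
    have hTR := congrArg T (hright (S x))
    rw [map_sub] at hTR
    rw [map_add, map_add, ← hTR]
    abel
  · change x - T (S x) + T (R (S (x - T (S x)))) = x
    rw [map_sub S, hleft, sub_add_cancel]

theorem isUnit_iff_exists_mul_norm_le [NormedAddCommGroup X] [InnerProductSpace ℂ X]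
    [CompleteSpace X] (D : X →L[ℂ] X) [hD : IsStarNormal D] :
    IsUnit D ↔ ∃ c > 0, ∀ x, c * ‖x‖ ≤ ‖D x‖ := by
  rw [ContinuousLinearMap.isUnit_iff_bijective,
    ContinuousLinearMap.bijective_iff_dense_range_and_antilipschitz,
    antilipschitzWith_iff_exists_mul_le_norm, and_iff_right_of_imp]
  rintro ⟨c, hc, hbound⟩
  rw [Submodule.topologicalClosure_eq_top_iff, ContinuousLinearMap.IsStarNormal.orthogonal_range hD,
    Submodule.eq_bot_iff]
  intro x hx
  have hcx : c * ‖x‖ ≤ 0 := by simpa only [show D x = 0 from hx, norm_zero] using hbound x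
  exact norm_le_zero_iff.1 (nonpos_of_mul_nonpos_right hcx hc)

end Operators

section FormOperator

variable {H N E V : Type*} [NormedAddCommGroup H] [InnerProductSpace ℂ H] [NormedAddCommGroup N]
  [InnerProductSpace ℂ N] [AddCommGroup E] [Module ℂ E] [NormedAddCommGroup V]
  [InnerProductSpace ℂ V]

/-- `f` is in the domain of the operator of the form `φ, ψ ↦ ⟪b ψ, b φ⟫` on `E`, and is mapped to
`h`. -/
def FormOperator (a : E →ₗ[ℂ] H) (b : E →ₗ[ℂ] N) (f h : H) : Prop :=
  ∃ φ : ℕ → E, Tendsto (fun m => a (φ m)) atTop (𝓝 f) ∧ CauchySeq (fun m => b (φ m)) ∧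
    ∀ ψ, Tendsto (fun m => inner ℂ (b ψ) (b (φ m))) atTop (𝓝 (inner ℂ (a ψ) h))

/-- `z` is in the resolvent set of the operator of the form `φ, ψ ↦ ⟪b ψ, b φ⟫`. -/
def IsFormResolvent (a : E →ₗ[ℂ] H) (b : E →ₗ[ℂ] N) (z : ℂ) : Prop :=
  ∃ R : H →L[ℂ] H, (∀ h, FormOperator a b (R h) (h + z • R h)) ∧
    ∀ f h, FormOperator a b f h → R (h - z • f) = f

/-- The Hilbert space `V`, with maps `ι : E → V` and `j : V → H`, is the completion of `E` for the
norm `(‖a φ‖² + ‖b φ‖²)^(1/2)`. The form need not be closable, so `j` need not be injective. -/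
structure IsFormDomain (a : E →ₗ[ℂ] H) (b : E →ₗ[ℂ] N) (ι : E →ₗ[ℂ] V) (j : V →L[ℂ] H) : Prop where
  dense : DenseRange ι
  comp : ∀ φ, j (ι φ) = a φ
  inner_eq : ∀ ψ φ, inner ℂ (ι ψ) (ι φ) = inner ℂ (a ψ) (a φ) + inner ℂ (b ψ) (b φ)

namespace IsFormDomain

variable {a : E →ₗ[ℂ] H} {b : E →ₗ[ℂ] N} {ι : E →ₗ[ℂ] V} {j : V →L[ℂ] H}

theorem norm_sq (hV : IsFormDomain a b ι j) (φ : E) : ‖ι φ‖ ^ 2 = ‖a φ‖ ^ 2 + ‖b φ‖ ^ 2 := by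
  have hinner := hV.inner_eq φ φ
  simp only [inner_self_eq_norm_sq_to_K] at hinner
  exact_mod_cast hinner

theorem cauchySeq_iff (hV : IsFormDomain a b ι j) {φ : ℕ → E} :
    CauchySeq (fun m => ι (φ m)) ↔ CauchySeq (fun m => a (φ m)) ∧ CauchySeq fun m => b (φ m) := by
  simp only [cauchySeq_iff_tendsto_dist_atTop_0, dist_eq_norm, ← map_sub]
  have hnorm_sq := fun p : ℕ × ℕ => hV.norm_sq (φ p.1 - φ p.2)
  refine ⟨fun hι => ⟨?_, ?_⟩, fun ⟨ha, hb⟩ => ?_⟩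
  · refine squeeze_zero (fun _ => norm_nonneg _) (fun p => ?_) hι
    nlinarith [hnorm_sq p, norm_nonneg (ι (φ p.1 - φ p.2))]
  · refine squeeze_zero (fun _ => norm_nonneg _) (fun p => ?_) hι
    nlinarith [hnorm_sq p, norm_nonneg (ι (φ p.1 - φ p.2))]
  · refine squeeze_zero (fun _ => norm_nonneg _) (fun p => ?_)
      (by simpa only [add_zero] using ha.add hb)
    nlinarith [hnorm_sq p, norm_nonneg (a (φ p.1 - φ p.2)), norm_nonneg (b (φ p.1 - φ p.2))]

theorem norm_le_of_forall (hV : IsFormDomain a b ι j) {C : ℝ} (hC : 0 ≤ C) {x : V}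
    (h : ∀ ψ, ‖inner ℂ (ι ψ) x‖ ≤ C * ‖ι ψ‖) : ‖x‖ ≤ C := by
  have hinner : ‖(inner ℂ x x : ℂ)‖ ≤ C * ‖x‖ :=
    hV.dense.induction_on (p := fun w => ‖inner ℂ w x‖ ≤ C * ‖w‖) x
      (isClosed_le (by fun_prop) (by fun_prop)) h
  rcases (norm_nonneg x).eq_or_lt with hx | hx
  · rwa [← hx]
  · refine le_of_mul_le_mul_right ?_ hx
    simpa [inner_self_eq_norm_sq_to_K, sq] using hinner

theorem eq_iff_forall_inner (hV : IsFormDomain a b ι j) {x y : V} :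
    x = y ↔ ∀ ψ, inner ℂ (ι ψ) x = inner ℂ (ι ψ) y := by
  refine ⟨fun h _ => h ▸ rfl, fun h => sub_eq_zero.1 (norm_le_zero_iff.1 ?_)⟩
  exact hV.norm_le_of_forall le_rfl fun ψ => by
    rw [inner_sub_right, h, sub_self, norm_zero, zero_mul]

variable [CompleteSpace V] [CompleteSpace H]

open ContinuousLinearMap (adjoint)

theorem forall_tendsto_inner_iff (hV : IsFormDomain a b ι j) {φ : ℕ → E} {v : V}
    (hφ : Tendsto (fun m => ι (φ m)) atTop (𝓝 v)) (h : H) :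
    (∀ ψ, Tendsto (fun m => inner ℂ (b ψ) (b (φ m))) atTop (𝓝 (inner ℂ (a ψ) h))) ↔
      v = adjoint j (j v + h) := by
  have hlim (ψ : E) : Tendsto (fun m => inner ℂ (b ψ) (b (φ m))) atTop
      (𝓝 (inner ℂ (ι ψ) v - inner ℂ (a ψ) (j v))) := by
    have ha : Tendsto (fun m => a (φ m)) atTop (𝓝 (j v)) := by
      simpa only [Function.comp_def, hV.comp] using (j.continuous.tendsto v).comp hφ
    refine ((tendsto_const_nhds.inner hφ).sub (tendsto_const_nhds.inner ha)).congr fun m => ?_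
    rw [hV.inner_eq, add_sub_cancel_left]
  rw [hV.eq_iff_forall_inner]
  refine forall_congr' fun ψ => ?_
  rw [ContinuousLinearMap.adjoint_inner_right, hV.comp, inner_add_right, ← sub_eq_iff_eq_add']
  exact ⟨tendsto_nhds_unique (hlim ψ), fun heq => heq ▸ hlim ψ⟩

theorem formOperator_iff (hV : IsFormDomain a b ι j) (f h : H) :
    FormOperator a b f h ↔ f = j (adjoint j (f + h)) := by
  constructor
  · rintro ⟨φ, ha, hb, hinner⟩
    obtain ⟨v, hv⟩ := cauchySeq_tendsto_of_complete (hV.cauchySeq_iff.2 ⟨ha.cauchySeq, hb⟩)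
    have hjv : j v = f := by
      refine tendsto_nhds_unique ((j.continuous.tendsto v).comp hv) ?_
      simpa only [Function.comp_def, hV.comp] using ha
    rw [← hjv]
    exact congrArg j ((hV.forall_tendsto_inner_iff hv h).1 hinner)
  · intro hf
    obtain ⟨u, hu, hlim⟩ := mem_closure_iff_seq_limit.1 (hV.dense (adjoint j (f + h)))
    choose φ hφ using hu
    obtain rfl : (fun m => ι (φ m)) = u := funext hφ
    refine ⟨φ, ?_, (hV.cauchySeq_iff.1 hlim.cauchySeq).2,
      (hV.forall_tendsto_inner_iff hlim h).2 (by rw [← hf])⟩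
    have ha := (j.continuous.tendsto _).comp hlim
    rw [← hf] at ha
    simpa only [Function.comp_def, hV.comp] using ha

theorem isUnit_of_isFormResolvent (hV : IsFormDomain a b ι j) {z : ℂ}
    (hz : IsFormResolvent a b z) : IsUnit (1 - ((1 + z) • j) ∘L adjoint j) := by
  simp only [IsFormResolvent, hV.formOperator_iff] at hz
  obtain ⟨R, hright, hleft⟩ := hz
  have hR (h : H) : R h = j (adjoint j h) + (1 + z) • j (adjoint j (R h)) := by
    conv_lhs => rw [hright h]
    simp only [map_add, map_smul, add_smul, one_smul]
    abel
  have hRj (k : H) : R (k - (1 + z) • j (adjoint j k)) = j (adjoint j k) := by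
    rw [add_smul, one_smul, ← sub_sub]
    exact hleft _ _ (by rw [add_sub_cancel])
  refine isUnit_iff_exists.2 ⟨1 + (1 + z) • R, ?_, ?_⟩ <;> ext h
  · change h + (1 + z) • R h - (1 + z) • j (adjoint j (h + (1 + z) • R h)) = h
    rw [map_add, map_add, map_smul, map_smul, ← hR, add_sub_cancel_right]
  · change h - (1 + z) • j (adjoint j h) + (1 + z) • R (h - (1 + z) • j (adjoint j h)) = h
    rw [hRj, sub_add_cancel]

theorem isFormResolvent_of_isUnit (hV : IsFormDomain a b ι j) {z : ℂ}
    (hz : IsUnit (1 - ((1 + z) • j) ∘L adjoint j)) : IsFormResolvent a b z := by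
  simp only [IsFormResolvent, hV.formOperator_iff]
  obtain ⟨S, hright, hleft⟩ := isUnit_iff_exists.1 hz
  replace hright (y : H) : S y - (1 + z) • j (adjoint j (S y)) = y := congr($hright y)
  replace hleft (y : H) : S (y - (1 + z) • j (adjoint j y)) = y := congr($hleft y)
  refine ⟨j ∘L adjoint j ∘L S, fun h => ?_, fun f h hf => ?_⟩
  · change j (adjoint j (S h)) = j (adjoint j (j (adjoint j (S h)) + (h + z • j (adjoint j (S h)))))
    have hS : j (adjoint j (S h)) + (h + z • j (adjoint j (S h))) = S h :=
      calc _ = h + (1 + z) • j (adjoint j (S h)) := by rw [add_smul, one_smul]; abel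
        _ = S h := (sub_eq_iff_eq_add.1 (hright h)).symm
    rw [hS]
  · change j (adjoint j (S (h - z • f))) = f
    have hshift : h - z • f = (f + h) - (1 + z) • j (adjoint j (f + h)) := by
      rw [← hf, add_smul, one_smul]
      abel
    rw [hshift, hleft, ← hf]

theorem isFormResolvent_iff (hV : IsFormDomain a b ι j) (z : ℂ) :
    IsFormResolvent a b z ↔ ∃ c > 0, ∀ (φ : E) (C : ℝ), 0 ≤ C →
      (∀ ψ, ‖inner ℂ (b ψ) (b φ) - z * inner ℂ (a ψ) (a φ)‖ ≤ C * ‖ι ψ‖) → c * ‖ι φ‖ ≤ C := by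
  have hunit : IsFormResolvent a b z ↔ IsUnit (1 - (1 + z) • (adjoint j ∘L j)) := by
    rw [← ContinuousLinearMap.comp_smul]
    exact ⟨fun hz => isUnit_one_sub_comp_comm (hV.isUnit_of_isFormResolvent hz),
      fun hz => hV.isFormResolvent_of_isUnit (isUnit_one_sub_comp_comm hz)⟩
  have hnormal : IsStarNormal (adjoint j ∘L j) :=
    (ContinuousLinearMap.isPositive_adjoint_comp_self j).isSelfAdjoint.isStarNormal
  have hinner (ψ φ : E) : inner ℂ (ι ψ) ((1 - (1 + z) • (adjoint j ∘L j)) (ι φ)) =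
      inner ℂ (b ψ) (b φ) - z * inner ℂ (a ψ) (a φ) := by
    change inner ℂ (ι ψ) (ι φ - (1 + z) • adjoint j (j (ι φ))) = _
    rw [inner_sub_right, inner_smul_right, ContinuousLinearMap.adjoint_inner_right, hV.inner_eq,
      hV.comp, hV.comp]
    ring
  rw [hunit, isUnit_iff_exists_mul_norm_le]
  simp only [← hinner]
  refine exists_congr fun c => and_congr_right fun _ =>
    ⟨fun hbound φ C hC hψ => ?_, fun hbound x => ?_⟩
  · exact (hbound _).trans (hV.norm_le_of_forall hC hψ)
  · refine hV.dense.induction_on (p := fun x => c * ‖x‖ ≤ ‖(1 - (1 + z) • (adjoint j ∘L j)) x‖) x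
      (isClosed_le (by fun_prop) (by fun_prop)) fun φ => hbound φ _ (norm_nonneg _) fun ψ => ?_
    rw [mul_comm]
    exact norm_inner_le_norm _ _

end IsFormDomain

variable [CompleteSpace H] [CompleteSpace N]

theorem exists_isFormDomain (a : E →ₗ[ℂ] H) (b : E →ₗ[ℂ] N) :
    ∃ (V : Submodule ℂ (WithLp 2 (H × N))) (_ : CompleteSpace V) (ι : E →ₗ[ℂ] V) (j : V →L[ℂ] H),
      IsFormDomain a b ι j := by
  let Φ : E →ₗ[ℂ] WithLp 2 (H × N) :=
    (WithLp.linearEquiv 2 ℂ (H × N)).symm.toLinearMap ∘ₗ (a.prod b)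
  let V := (LinearMap.range Φ).topologicalClosure
  let ι : E →ₗ[ℂ] V := Φ.codRestrict V fun φ => Submodule.le_topologicalClosure _ ⟨φ, rfl⟩
  have hdense : DenseRange ι := by
    rw [DenseRange, Subtype.dense_iff, ← Set.range_comp]
    exact subset_rfl
  exact ⟨V, (Submodule.isClosed_topologicalClosure _).completeSpace_coe, ι,
    (WithLp.fstL 2 ℂ H N).comp V.subtypeL, hdense, fun _ => rfl,
    fun _ _ => WithLp.prod_inner_apply _ _⟩

/-- The inf-sup criterion: a spectral parameter is detected by test vectors `φ`, `ψ` in the form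
core `E`, with no knowledge of the operator domain. -/
theorem isFormResolvent_iff_exists_bound (a : E →ₗ[ℂ] H) (b : E →ₗ[ℂ] N) (z : ℂ) :
    IsFormResolvent a b z ↔ ∃ c > 0, ∀ (φ : E) (C : ℝ), 0 ≤ C →
      (∀ ψ, ‖inner ℂ (b ψ) (b φ) - z * inner ℂ (a ψ) (a φ)‖ ≤ C * √(‖a ψ‖ ^ 2 + ‖b ψ‖ ^ 2)) →
        c * √(‖a φ‖ ^ 2 + ‖b φ‖ ^ 2) ≤ C := by
  obtain ⟨V, _, ι, j, hV⟩ := exists_isFormDomain a b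
  have hnorm (φ : E) : √(‖a φ‖ ^ 2 + ‖b φ‖ ^ 2) = ‖ι φ‖ := by
    rw [← hV.norm_sq, Real.sqrt_sq (norm_nonneg _)]
  simp only [hV.isFormResolvent_iff, hnorm]

end FormOperator

end

noncomputable section

/-! ### Smooth functions on `G` and on `Γ\G` -/

section SmoothFunctions

variable {n : ℕ} {G : ClosedSubgroup (GL (Fin n) ℝ)}

theorem tendsto_mul_expG_smul (g : G) (Y : lieAlgebra G) :
    Tendsto (fun t : ℝ => g * expG (t • Y)) (𝓝 0) (𝓝 g) :=
  (continuous_const.mul (continuous_expG.comp (by fun_prop))).tendsto' _ _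
    (by simp only [Pi.mul_apply, Function.comp_apply, zero_smul, expG_zero, mul_one])

theorem continuous_mul_expG_sum {ι : Type*} [Fintype ι] (g : G) (Y : ι → lieAlgebra G) :
    Continuous fun t : ι → ℝ => g * expG (∑ i, t i • Y i) :=
  continuous_const.mul (continuous_expG.comp (continuous_finsetSum _ fun i _ =>
    (continuous_apply i).smul continuous_const))

theorem map_mul_expG_basis_nhds_zero {ι : Type*} [Fintype ι] (b : Module.Basis ι ℝ (lieAlgebra G))
    (g : G) : map (fun t : ι → ℝ => g * expG (∑ i, t i • b i)) (𝓝 0) = 𝓝 g := by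
  have hcoord : map (fun t : ι → ℝ => ∑ i, t i • b i) (𝓝 0) = 𝓝 (0 : lieAlgebra G) := by
    have hmap := b.equivFun.symm.toContinuousLinearEquiv.toHomeomorph.map_nhds_eq 0
    have hequiv : ⇑b.equivFun.symm.toContinuousLinearEquiv.toHomeomorph =
        fun t : ι → ℝ => ∑ i, t i • b i := funext b.equivFun_symm_apply
    rw [hequiv] at hmap
    simpa only [Pi.zero_apply, zero_smul, Finset.sum_const_zero] using hmap
  change map ((g * ·) ∘ expG ∘ fun t : ι → ℝ => ∑ i, t i • b i) (𝓝 0) = 𝓝 g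
  rw [← Filter.map_map, ← Filter.map_map, hcoord, map_expG_nhds_zero]
  simpa only [Homeomorph.coe_mulLeft, mul_one] using (Homeomorph.mulLeft g).map_nhds_eq 1

section GroupDeriv

variable {F : Type*} [NormedAddCommGroup F] [NormedSpace ℝ F] {u v : G → F}

/-- Smoothness of a function on `G`, tested in the exponential coordinates `Y ↦ g exp Y` as in
`IsTestFunction`. -/
def ExpSmooth (u : G → F) : Prop :=
  ∀ (g : G) (m : ℕ) (Y : Fin m → lieAlgebra G),
    ContDiff ℝ ∞ fun t : Fin m → ℝ => u (g * expG (∑ i, t i • Y i))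

/-- The derivative of `u` along the left invariant vector field `Y`; it is `lieDeriv` for functions
on `G` itself. -/
def groupDeriv (Y : lieAlgebra G) (u : G → F) (g : G) : F :=
  deriv (fun t : ℝ => u (g * expG (t • Y))) 0

theorem groupDeriv_eq_of_eventuallyEq {g : G} (h : u =ᶠ[𝓝 g] v) (Y : lieAlgebra G) :
    groupDeriv Y u g = groupDeriv Y v g :=
  EventuallyEq.deriv_eq ((tendsto_mul_expG_smul g Y).eventually h)

theorem groupDeriv_eq_zero {g : G} (hg : g ∉ tsupport u) (Y : lieAlgebra G) :
    groupDeriv Y u g = 0 := by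
  rw [groupDeriv_eq_of_eventuallyEq (notMem_tsupport_iff_eventuallyEq.1 hg) Y]
  exact deriv_const _ _

namespace ExpSmooth

theorem hasDerivAt (hu : ExpSmooth u) (Y : lieAlgebra G) (g : G) :
    HasDerivAt (fun t : ℝ => u (g * expG (t • Y))) (groupDeriv Y u g) 0 := by
  have hdiag : ContDiff ℝ ∞ fun t : ℝ => fun _ : Fin 1 => t := by fun_prop
  have hdiff := ((hu g 1 fun _ => Y).comp hdiag).differentiable (by simp) 0
  simp only [Function.comp_def, Fin.sum_univ_one] at hdiff
  exact hdiff.hasDerivAt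

theorem continuous (hu : ExpSmooth u) : Continuous u := by
  refine continuous_iff_continuousAt.2 fun g => ?_
  have hchart := (hu g _ (Module.finBasis ℝ (lieAlgebra G))).continuous
  rw [ContinuousAt, ← map_mul_expG_basis_nhds_zero (Module.finBasis ℝ (lieAlgebra G)) g,
    tendsto_map'_iff]
  exact hchart.tendsto' _ _ (by
    simp only [Pi.zero_apply, zero_smul, Finset.sum_const_zero, expG_zero, mul_one])

theorem continuous_groupDeriv (hu : ExpSmooth u) (Y : lieAlgebra G) :
    Continuous (groupDeriv Y u) := by
  refine continuous_iff_continuousAt.2 fun g => ?_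
  let b := Module.finBasis ℝ (lieAlgebra G)
  obtain ⟨Θ, hΘ, hmul⟩ := exists_contDiffAt_expG_mul b Y
  let Ψ (t : Fin (Module.finrank ℝ (lieAlgebra G)) → ℝ) (s : ℝ) : F :=
    u (g * expG (∑ i, Θ (t, s) i • b i))
  have hΨ : ContDiffAt ℝ ∞ (Function.uncurry Ψ) (0, 0) := (hu g _ b).contDiffAt.comp _ hΘ
  have hpartial : ContinuousAt (fun t => deriv (Ψ t) 0) 0 :=
    ((hΨ.fderiv (g := fun _ => 0) (m := 0) contDiffAt_const (by simp)).continuousAt).clm_apply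
      continuousAt_const
  have hchart : (fun t => deriv (Ψ t) 0) =ᶠ[𝓝 0]
      fun t => groupDeriv Y u (g * expG (∑ i, t i • b i)) := by
    rw [← Prod.mk_zero_zero] at hmul
    filter_upwards [hmul.curry_nhds] with t ht
    refine EventuallyEq.deriv_eq ?_
    filter_upwards [ht] with s hs
    rw [mul_assoc, hs]
  have hvalue : groupDeriv Y u g = deriv (Ψ 0) 0 := by
    simpa only [Pi.zero_apply, zero_smul, Finset.sum_const_zero, expG_zero, mul_one] using
      hchart.self_of_nhds.symm
  rw [ContinuousAt, ← map_mul_expG_basis_nhds_zero b g, tendsto_map'_iff, hvalue]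
  exact hpartial.tendsto.congr' hchart

end ExpSmooth

end GroupDeriv

open RightCosets

variable {K Γ : Subgroup G} {φ ψ : RightCosets Γ → ℂ}

theorem groupDeriv_comp_cosetMap (φ : RightCosets Γ → ℂ) (Y : lieAlgebra G) (g h : G) :
    groupDeriv Y (fun h => φ (cosetMap Γ g h)) h = lieDeriv Y φ (cosetMap Γ g h) := by
  simp only [groupDeriv, lieDeriv, op_smul_cosetMap]

theorem lieDeriv_eq_zero {x : RightCosets Γ} (hx : x ∉ tsupport φ) (Y : lieAlgebra G) :
    lieDeriv Y φ x = 0 := by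
  obtain ⟨h, rfl⟩ := cosetMap_surjective Γ 1 x
  rw [← groupDeriv_comp_cosetMap]
  exact groupDeriv_eq_zero (fun hh => hx
    (tsupport_comp_subset_preimage φ (continuous_cosetMap Γ 1) hh)) Y

namespace IsTestFunction

theorem expSmooth (hφ : IsTestFunction K Γ φ) (g : G) :
    ExpSmooth fun h => φ (cosetMap Γ g h) := by
  intro h m Y
  simp only [← op_smul_cosetMap]
  exact hφ.smooth _ m Y

theorem comp_cosetMap_mul (hφ : IsTestFunction K Γ φ) (g h : G) {k : G} (hk : k ∈ K) :
    φ (cosetMap Γ g (h * k)) = φ (cosetMap Γ g h) := by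
  rw [← op_smul_cosetMap, hφ.invariant k hk]

theorem hasDerivAt (hφ : IsTestFunction K Γ φ) (Y : lieAlgebra G) (x : RightCosets Γ) :
    HasDerivAt (fun t : ℝ => φ (MulOpposite.op (expG (t • Y)) • x)) (lieDeriv Y φ x) 0 := by
  obtain ⟨h, rfl⟩ := cosetMap_surjective Γ 1 x
  simpa only [op_smul_cosetMap, groupDeriv_comp_cosetMap] using (hφ.expSmooth 1).hasDerivAt Y h

theorem continuous (hφ : IsTestFunction K Γ φ) : Continuous φ :=
  ((isOpenMap_cosetMap Γ 1).isQuotientMap (continuous_cosetMap Γ 1)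
    (cosetMap_surjective Γ 1)).continuous_iff.2 (hφ.expSmooth 1).continuous

theorem continuous_lieDeriv (hφ : IsTestFunction K Γ φ) (Y : lieAlgebra G) :
    Continuous (lieDeriv Y φ) := by
  refine ((isOpenMap_cosetMap Γ 1).isQuotientMap (continuous_cosetMap Γ 1)
    (cosetMap_surjective Γ 1)).continuous_iff.2 ?_
  simpa only [Function.comp_def, ← groupDeriv_comp_cosetMap] using
    (hφ.expSmooth 1).continuous_groupDeriv Y

theorem hasCompactSupport_lieDeriv (hφ : IsTestFunction K Γ φ) (Y : lieAlgebra G) :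
    HasCompactSupport (lieDeriv Y φ) :=
  hφ.compact.mono' fun _ hx => not_imp_comm.1 (fun hxφ => lieDeriv_eq_zero hxφ Y) hx

theorem add (hφ : IsTestFunction K Γ φ) (hψ : IsTestFunction K Γ ψ) :
    IsTestFunction K Γ (φ + ψ) where
  smooth x m Y := (hφ.smooth x m Y).add (hψ.smooth x m Y)
  invariant k hk x := congrArg₂ (· + ·) (hφ.invariant k hk x) (hψ.invariant k hk x)
  compact := hφ.compact.add hψ.compact

theorem smul (hφ : IsTestFunction K Γ φ) (c : ℂ) : IsTestFunction K Γ (c • φ) where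
  smooth x m Y := contDiff_const.smul (hφ.smooth x m Y)
  invariant k hk x := congrArg (c • ·) (hφ.invariant k hk x)
  compact := hφ.compact.smul_left (f := fun _ => c)

theorem lieDeriv_add (hφ : IsTestFunction K Γ φ) (hψ : IsTestFunction K Γ ψ) (Y : lieAlgebra G) :
    lieDeriv Y (φ + ψ) = lieDeriv Y φ + lieDeriv Y ψ :=
  funext fun x => ((hφ.hasDerivAt Y x).add (hψ.hasDerivAt Y x)).deriv

theorem lieDeriv_smul (hφ : IsTestFunction K Γ φ) (c : ℂ) (Y : lieAlgebra G) :
    lieDeriv Y (c • φ) = c • lieDeriv Y φ :=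
  funext fun x => ((hφ.hasDerivAt Y x).const_smul c).deriv

end IsTestFunction

variable (K Γ) in
/-- The space `C_c^∞(Γ\X)`, bundled as the core of the Dirichlet form. -/
def testSpace : Submodule ℂ (RightCosets Γ → ℂ) where
  carrier := {φ | IsTestFunction K Γ φ}
  add_mem' := IsTestFunction.add
  zero_mem' :=
    { smooth := fun _ _ _ => contDiff_const
      invariant := fun _ _ _ => rfl
      compact := HasCompactSupport.zero }
  smul_mem' := fun c _ hφ => hφ.smul c

end SmoothFunctions

/-! ### The Dirichlet form -/

section Dirichlet

open RightCosets

variable {n : ℕ} {G : ClosedSubgroup (GL (Fin n) ℝ)} [MeasurableSpace G] [BorelSpace G]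
  {K Γ : Subgroup G} [DiscreteTopology Γ] (μ : Measure G) [μ.IsHaarMeasure]

namespace IsTestFunction

variable {φ : RightCosets Γ → ℂ}

theorem memLp (hφ : IsTestFunction K Γ φ) : MemLp φ 2 (quotientMeasure Γ μ) :=
  hφ.continuous.memLp_of_hasCompactSupport hφ.compact

theorem memLp_lieDeriv (hφ : IsTestFunction K Γ φ) (Y : lieAlgebra G) :
    MemLp (lieDeriv Y φ) 2 (quotientMeasure Γ μ) :=
  (hφ.continuous_lieDeriv Y).memLp_of_hasCompactSupport (hφ.hasCompactSupport_lieDeriv Y)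

end IsTestFunction

variable (K Γ) in
/-- The derivative along `Y`, as an unbounded operator from `C_c^∞(Γ\X)` to `L²(Γ\G)`. The
derivative of a `K`-invariant function need not be `K`-invariant, so it does not map to
`L²(Γ\X)`. -/
def testDeriv (Y : lieAlgebra G) : testSpace K Γ →ₗ[ℂ] Lp ℂ 2 (quotientMeasure Γ μ) where
  toFun φ := (IsTestFunction.memLp_lieDeriv μ φ.2 Y).toLp _
  map_add' φ ψ := by
    rw [← MemLp.toLp_add (IsTestFunction.memLp_lieDeriv μ φ.2 Y)
      (IsTestFunction.memLp_lieDeriv μ ψ.2 Y)]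
    exact MemLp.toLp_congr _ _ (by rw [← IsTestFunction.lieDeriv_add φ.2 ψ.2]; rfl)
  map_smul' c φ := by
    rw [RingHom.id_apply, ← MemLp.toLp_const_smul c (IsTestFunction.memLp_lieDeriv μ φ.2 Y)]
    exact MemLp.toLp_congr _ _ (by rw [← IsTestFunction.lieDeriv_smul φ.2]; rfl)

variable {d : ℕ} (e : Fin d → lieAlgebra G)

variable (K Γ) in
/-- The gradient of a test function, given by its coordinates in the frame `e`. -/
def testGrad : testSpace K Γ →ₗ[ℂ] PiLp 2 fun _ : Fin d => Lp ℂ 2 (quotientMeasure Γ μ) :=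
  (WithLp.linearEquiv 2 ℂ (Fin d → Lp ℂ 2 (quotientMeasure Γ μ))).symm.toLinearMap ∘ₗ
    LinearMap.pi fun i => testDeriv K Γ μ (e i)

theorem inner_testGrad (φ ψ : testSpace K Γ) :
    inner ℂ (testGrad K Γ μ e ψ) (testGrad K Γ μ e φ) =
      ∑ i, ∫ x, conj (lieDeriv (e i) ψ.1 x) * lieDeriv (e i) φ.1 x ∂(quotientMeasure Γ μ) := by
  rw [PiLp.inner_apply]
  exact Finset.sum_congr rfl fun i _ => inner_toLp_toLp
    (IsTestFunction.memLp_lieDeriv μ ψ.2 (e i)) (IsTestFunction.memLp_lieDeriv μ φ.2 (e i))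

theorem dirichletForm_eq_inner (φ ψ : testSpace K Γ) :
    dirichletForm μ e φ.1 ψ.1 = inner ℂ (testGrad K Γ μ e ψ) (testGrad K Γ μ e φ) := by
  rw [inner_testGrad, dirichletForm, integral_finsetSum]
  · simp only [mul_comm]
  · exact fun i _ => (IsTestFunction.memLp_lieDeriv μ φ.2 (e i)).integrable_mul
      (IsTestFunction.memLp_lieDeriv μ ψ.2 (e i)).star

theorem norm_dirichletForm_sub_self (φ ψ : testSpace K Γ) :
    ‖dirichletForm μ e (φ.1 - ψ.1) (φ.1 - ψ.1)‖ =
      dist (testGrad K Γ μ e φ) (testGrad K Γ μ e ψ) ^ 2 := by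
  have hinner := dirichletForm_eq_inner μ e (φ - ψ) (φ - ψ)
  rw [inner_self_eq_norm_sq_to_K, map_sub, ← dist_eq_norm] at hinner
  change dirichletForm μ e (φ.1 - ψ.1) (φ.1 - ψ.1) = _ at hinner
  rw [hinner, norm_pow, RCLike.norm_ofReal, abs_of_nonneg dist_nonneg]

theorem cauchySeq_testGrad_iff (φ : ℕ → testSpace K Γ) :
    CauchySeq (fun m => testGrad K Γ μ e (φ m)) ↔ ∀ ε : ℝ, 0 < ε → ∃ N : ℕ, ∀ m ≥ N, ∀ m' ≥ N,
      ‖dirichletForm μ e ((φ m).1 - (φ m').1) ((φ m).1 - (φ m').1)‖ < ε := by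
  simp only [norm_dirichletForm_sub_self, Metric.cauchySeq_iff]
  refine ⟨fun h ε hε => ?_, fun h ε hε => ?_⟩
  · obtain ⟨N, hN⟩ := h (√ε) (Real.sqrt_pos.2 hε)
    exact ⟨N, fun m hm m' hm' => (Real.lt_sqrt dist_nonneg).1 (hN m hm m' hm')⟩
  · obtain ⟨N, hN⟩ := h (ε ^ 2) (by positivity)
    exact ⟨N, fun m hm m' hm' => lt_of_pow_lt_pow_left₀ 2 hε.le (hN m hm m' hm')⟩

/-- The square of the norm of a test function in `W¹(Γ\X)`. -/
def energy (φ : RightCosets Γ → ℂ) : ℝ :=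
  ∫ x, ‖φ x‖ ^ 2 ∂(quotientMeasure Γ μ) +
    ∑ i, ∫ x, ‖lieDeriv (e i) φ x‖ ^ 2 ∂(quotientMeasure Γ μ)

/-- The sesquilinear form `∫ ⟨grad φ, grad ψ⟩ - z ∫ φ ψ̄` of the operator `-Δ - z`. -/
def shiftedForm (z : ℂ) (φ ψ : RightCosets Γ → ℂ) : ℂ :=
  ∑ i, ∫ x, conj (lieDeriv (e i) ψ x) * lieDeriv (e i) φ x ∂(quotientMeasure Γ μ) -
    z * ∫ x, conj (ψ x) * φ x ∂(quotientMeasure Γ μ)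

variable [μ.IsMulRightInvariant]

instance instCompleteSpaceL2X : CompleteSpace (L2X K Γ μ) := by
  have hinter : (L2X K Γ μ : Set (Lp ℂ 2 (quotientMeasure Γ μ))) = ⋂ k ∈ K,
      {f | rightRep G (RightCosets Γ) (quotientMeasure Γ μ) k f = f} := by
    ext f
    simp only [Set.mem_iInter]
    exact Iff.rfl
  have hclosed : IsClosed (L2X K Γ μ : Set (Lp ℂ 2 (quotientMeasure Γ μ))) := by
    rw [hinter]
    exact isClosed_biInter fun k _ => isClosed_eq (LinearIsometryEquiv.continuous _) continuous_id
  exact hclosed.completeSpace_coe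

variable (K Γ) in
/-- The inclusion of `C_c^∞(Γ\X)` in `L²(Γ\X)`. -/
def testToL2X : testSpace K Γ →ₗ[ℂ] L2X K Γ μ where
  toFun φ := ⟨(IsTestFunction.memLp μ φ.2).toLp φ.1, fun k hk => by
    rw [rightRep_toLp]
    exact MemLp.toLp_congr _ _ (Eventually.of_forall fun x => φ.2.invariant k hk x)⟩
  map_add' φ ψ := Subtype.ext
    (MemLp.toLp_add (IsTestFunction.memLp μ φ.2) (IsTestFunction.memLp μ ψ.2))
  map_smul' c φ := Subtype.ext (MemLp.toLp_const_smul c (IsTestFunction.memLp μ φ.2))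

theorem inner_testToL2X (φ ψ : testSpace K Γ) :
    inner ℂ (testToL2X K Γ μ ψ) (testToL2X K Γ μ φ) =
      ∫ x, conj (ψ.1 x) * φ.1 x ∂(quotientMeasure Γ μ) :=
  inner_toLp_toLp (IsTestFunction.memLp μ ψ.2) (IsTestFunction.memLp μ φ.2)

theorem inner_testToL2X_left (ψ : testSpace K Γ) (h : L2X K Γ μ) :
    inner ℂ (testToL2X K Γ μ ψ) h = ∫ x, h.1 x * conj (ψ.1 x) ∂(quotientMeasure Γ μ) := by
  change inner ℂ ((IsTestFunction.memLp μ ψ.2).toLp ψ.1) h.1 = _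
  rw [L2.inner_def]
  refine integral_congr_ae ?_
  filter_upwards [(IsTestFunction.memLp μ ψ.2).coeFn_toLp] with x hx
  rw [hx, RCLike.inner_apply]

theorem tendsto_testToL2X_iff (φ : ℕ → testSpace K Γ) (f : L2X K Γ μ) :
    Tendsto (fun m => testToL2X K Γ μ (φ m)) atTop (𝓝 f) ↔
      Tendsto (fun m => eLpNorm (fun x => (φ m).1 x - f.1 x) 2 (quotientMeasure Γ μ))
        atTop (𝓝 0) := by
  have hLp := Lp.tendsto_Lp_iff_tendsto_eLpNorm'' (fun m => (φ m).1)
    (fun m => IsTestFunction.memLp μ (φ m).2) f.1 (Lp.memLp f.1) (fi := atTop)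
  rw [Lp.toLp_coeFn] at hLp
  rw [tendsto_subtype_rng]
  exact hLp

theorem negLaplacian_iff_formOperator (f h : L2X K Γ μ) :
    NegLaplacian K Γ μ e f h ↔ FormOperator (testToL2X K Γ μ) (testGrad K Γ μ e) f h := by
  constructor
  · rintro ⟨φ, hφ, hψ⟩
    refine ⟨fun m => ⟨φ m, hφ.test m⟩, (tendsto_testToL2X_iff μ _ f).2 hφ.tendsto,
      (cauchySeq_testGrad_iff μ e _).2 hφ.cauchy, fun ψ => ?_⟩
    simp only [inner_testToL2X_left, ← dirichletForm_eq_inner]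
    exact hψ ψ.1 ψ.2
  · rintro ⟨φ, hφ, hgrad, hψ⟩
    simp only [inner_testToL2X_left, ← dirichletForm_eq_inner] at hψ
    exact ⟨fun m => (φ m).1, ⟨fun m => (φ m).2, (tendsto_testToL2X_iff μ φ f).1 hφ,
      (cauchySeq_testGrad_iff μ e φ).1 hgrad⟩, fun ψ hψ' => hψ ⟨ψ, hψ'⟩⟩

theorem notMem_laplaceSpectrum_iff (z : ℂ) :
    z ∉ laplaceSpectrum K Γ μ e ↔ IsFormResolvent (testToL2X K Γ μ) (testGrad K Γ μ e) z := by
  change ¬¬ _ ↔ _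
  simp only [not_not, negLaplacian_iff_formOperator]
  rfl

theorem norm_sq_testToL2X_add_norm_sq_testGrad (φ : testSpace K Γ) :
    ‖testToL2X K Γ μ φ‖ ^ 2 + ‖testGrad K Γ μ e φ‖ ^ 2 = energy μ e φ.1 := by
  have hL2 := (inner_self_eq_norm_sq_to_K (𝕜 := ℂ) (testToL2X K Γ μ φ)).symm.trans
    (inner_testToL2X μ φ φ)
  have hgrad := (inner_self_eq_norm_sq_to_K (𝕜 := ℂ) (testGrad K Γ μ e φ)).symm.trans
    (inner_testGrad μ e φ φ)
  refine Complex.ofReal_injective ?_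
  rw [energy]
  push_cast [← integral_complex_ofReal]
  simp only [RCLike.conj_mul] at hL2 hgrad
  exact congrArg₂ (· + ·) hL2 hgrad

theorem notMem_laplaceSpectrum_iff_exists_bound (z : ℂ) :
    z ∉ laplaceSpectrum K Γ μ e ↔ ∃ c > 0, ∀ φ, IsTestFunction K Γ φ → ∀ C : ℝ, 0 ≤ C →
      (∀ ψ, IsTestFunction K Γ ψ → ‖shiftedForm μ e z φ ψ‖ ≤ C * √(energy μ e ψ)) →
        c * √(energy μ e φ) ≤ C := by
  rw [notMem_laplaceSpectrum_iff, isFormResolvent_iff_exists_bound]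
  simp only [norm_sq_testToL2X_add_norm_sq_testGrad, inner_testToL2X, inner_testGrad,
    ← shiftedForm.eq_1]
  exact exists_congr fun c => and_congr_right fun _ =>
    ⟨fun h φ hφ C hC hψ => h ⟨φ, hφ⟩ C hC fun ψ => hψ ψ.1 ψ.2,
      fun h φ C hC hψ => h φ.1 φ.2 C hC fun ψ hψ' => hψ ⟨ψ, hψ'⟩⟩

end Dirichlet

end

noncomputable section

/-! ### Cutoff functions with uniformly bounded derivatives -/

section Entries

variable {n : ℕ} {G : ClosedSubgroup (GL (Fin n) ℝ)}

/-- The Euclidean space of pairs of `n × n` matrices. -/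
abbrev EntrySpace (n : ℕ) : Type :=
  EuclideanSpace ℝ ((Fin n × Fin n) ⊕ (Fin n × Fin n))

/-- The entries of `g` and of `g⁻¹`. The latter are included to make the norm of this vector a
proper function on `G`. -/
def entries (g : G) : EntrySpace n :=
  WithLp.toLp 2 (Sum.elim (fun p => toMatrix g p.1 p.2) (fun p => toMatrix g⁻¹ p.1 p.2))

/-- The action `(A, B) ↦ (A h, h⁻¹ B)` of `G` on pairs of matrices, for which `entries` is
equivariant. -/
def entriesAction (h : G) : EntrySpace n →L[ℝ] EntrySpace n :=
  LinearMap.toContinuousLinearMap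
    { toFun v := WithLp.toLp 2 (Sum.elim
        (fun p => ∑ k, v (.inl (p.1, k)) * toMatrix h k p.2)
        (fun p => ∑ k, toMatrix h⁻¹ p.1 k * v (.inr (k, p.2))))
      map_add' v w := by
        ext (p | p) <;> simp [add_mul, mul_add, Finset.sum_add_distrib]
      map_smul' c v := by
        ext (p | p) <;> simp [Finset.mul_sum, mul_assoc, mul_left_comm] }

theorem entries_mul (g h : G) : entries (g * h) = entriesAction h (entries g) := by
  ext (p | p)
  · exact congr_fun₂ (toMatrix_mul g h) p.1 p.2
  · change toMatrix (g * h)⁻¹ p.1 p.2 = _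
    rw [mul_inv_rev]
    exact congr_fun₂ (toMatrix_mul h⁻¹ g⁻¹) p.1 p.2

theorem expSmooth_toMatrix (i j : Fin n) : ExpSmooth fun g : G => toMatrix g i j :=
  fun g _ Y => contDiff_toMatrix_mul_expG Y g i j

theorem expSmooth_toMatrix_inv (i j : Fin n) : ExpSmooth fun g : G => toMatrix g⁻¹ i j := by
  intro g m Y
  have hinv (t : Fin m → ℝ) : toMatrix (g * expG (∑ i, t i • Y i))⁻¹ i j =
      ∑ k, toMatrix (1 * expG (∑ i, t i • -Y i)) i k * toMatrix g⁻¹ k j := by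
    simp only [smul_neg, Finset.sum_neg_distrib, expG_neg, one_mul]
    rw [mul_inv_rev, toMatrix_mul, Matrix.mul_apply]
  simp only [hinv]
  exact ContDiff.sum fun k _ => (contDiff_toMatrix_mul_expG _ 1 i k).mul contDiff_const

theorem expSmooth_entries : ExpSmooth (entries : G → EntrySpace n) := by
  intro g m Y
  refine contDiff_euclidean.2 ?_
  rintro (p | p)
  · exact expSmooth_toMatrix p.1 p.2 g m Y
  · exact expSmooth_toMatrix_inv p.1 p.2 g m Y

theorem expSmooth_entriesAction :
    ExpSmooth (entriesAction : G → EntrySpace n →L[ℝ] EntrySpace n) := by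
  intro g m Y
  refine contDiff_clm_apply_iff.2 fun v => contDiff_euclidean.2 ?_
  rintro (p | p)
  · change ContDiff ℝ ∞ fun t : Fin m → ℝ =>
      ∑ k, v (.inl (p.1, k)) * toMatrix (g * expG (∑ i, t i • Y i)) k p.2
    exact ContDiff.sum fun k _ => contDiff_const.mul (expSmooth_toMatrix k p.2 g m Y)
  · change ContDiff ℝ ∞ fun t : Fin m → ℝ =>
      ∑ k, toMatrix (g * expG (∑ i, t i • Y i))⁻¹ p.1 k * v (.inr (k, p.2))
    exact ContDiff.sum fun k _ => (expSmooth_toMatrix_inv p.1 k g m Y).mul contDiff_const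

theorem hasDerivAt_entries (Y : lieAlgebra G) (g : G) :
    HasDerivAt (fun t : ℝ => entries (g * expG (t • Y)))
      (groupDeriv Y entriesAction (1 : G) (entries g)) 0 := by
  simpa only [entries_mul, one_mul, map_zero, add_zero] using
    (expSmooth_entriesAction.hasDerivAt Y (1 : G)).clm_apply (hasDerivAt_const 0 (entries g))

theorem isCompact_norm_entries_le (R : ℝ) : IsCompact {g : G | ‖entries g‖ ≤ R} := by
  have hunits : IsClosedEmbedding fun g : G =>
      Units.embedProduct (Matrix (Fin n) (Fin n) ℝ) g.1 :=
    Units.isClosedEmbedding_embedProduct.comp (isClosedEmbedding_val_closedSubgroup G)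
  let pairOfEntries (v : EntrySpace n) : Matrix (Fin n) (Fin n) ℝ × (Matrix (Fin n) (Fin n) ℝ)ᵐᵒᵖ :=
    (fun i j => v (.inl (i, j)), MulOpposite.op fun i j => v (.inr (i, j)))
  have hcont : Continuous pairOfEntries :=
    (continuous_matrix fun i j => by fun_prop).prodMk
      (MulOpposite.continuous_op.comp (continuous_matrix fun i j => by fun_prop))
  have hcompact := hunits.isCompact_preimage
    ((isCompact_closedBall (0 : EntrySpace n) R).image hcont)
  refine hcompact.of_isClosed_subset
    (isClosed_le expSmooth_entries.continuous.norm continuous_const) fun g hg => ?_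
  exact ⟨entries g, mem_closedBall_zero_iff.2 hg, rfl⟩

end Entries

section AveragedNorm

variable {n : ℕ} {G : ClosedSubgroup (GL (Fin n) ℝ)} {K : Subgroup G} [MeasurableSpace K]
  (ν : Measure K)

/-- The average over `K` of the squared norm of the entries, shifted to be at least `1`: for a
right translation invariant `ν`, a right `K`-invariant function on `G`. -/
def averagedNormSq (g : G) : ℝ :=
  1 + ∫ k : K, ‖entries (g * (k : G))‖ ^ 2 ∂ν

/-- The positive operator whose quadratic form is the average over `K` of the squared norm. -/
def averagedGram : EntrySpace n →L[ℝ] EntrySpace n :=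
  ∫ k : K, (entriesAction (k : G)).adjoint ∘L entriesAction (k : G) ∂ν

theorem one_le_averagedNormSq (g : G) : 1 ≤ averagedNormSq ν g :=
  le_add_of_nonneg_right (integral_nonneg fun _ => sq_nonneg _)

theorem averagedNormSq_mul [BorelSpace K] [ν.IsMulLeftInvariant] (g : G) {k : G} (hk : k ∈ K) :
    averagedNormSq ν (g * k) = averagedNormSq ν g := by
  simpa only [averagedNormSq, Subgroup.coe_mul, mul_assoc] using
    congr(1 + $(integral_mul_left_eq_self (μ := ν)
      (fun k' : K => ‖entries (g * (k' : G))‖ ^ 2) ⟨k, hk⟩))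

variable [BorelSpace K] [CompactSpace K]

theorem averagedNormSq_eq_inner [IsFiniteMeasureOnCompacts ν] (g : G) :
    averagedNormSq ν g = 1 + inner ℝ (averagedGram ν (entries g)) (entries g) := by
  have haction : Continuous fun k : K => entriesAction (k : G) :=
    expSmooth_entriesAction.continuous.comp continuous_subtype_val
  have hgram : Integrable
      (fun k : K => (entriesAction (k : G)).adjoint ∘L entriesAction (k : G)) ν :=
    ((ContinuousLinearMap.adjoint.continuous.comp haction).clm_comp
      haction).integrable_of_hasCompactSupport (.of_compactSpace _)
  rw [averagedNormSq, averagedGram, ContinuousLinearMap.integral_apply hgram,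
    real_inner_comm, ← integral_inner (hgram.apply_continuousLinearMap _)]
  simp only [entries_mul, ContinuousLinearMap.comp_apply, ContinuousLinearMap.adjoint_inner_right,
    real_inner_self_eq_norm_sq]

theorem expSmooth_averagedNormSq [IsFiniteMeasureOnCompacts ν] :
    ExpSmooth (averagedNormSq ν) := by
  intro g m Y
  simp only [averagedNormSq_eq_inner]
  exact contDiff_const.add (((averagedGram ν).contDiff.comp (expSmooth_entries g m Y)).inner ℝ
    (expSmooth_entries g m Y))

theorem exists_norm_sq_entries_le [IsProbabilityMeasure ν] :
    ∃ M : ℝ, 0 ≤ M ∧ ∀ g, ‖entries g‖ ^ 2 ≤ M * averagedNormSq ν g := by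
  obtain ⟨M, hM⟩ := isCompact_univ.exists_bound_of_continuousOn
    (f := fun k : K => entriesAction (k : G)⁻¹)
    (expSmooth_entriesAction.continuous.comp continuous_subtype_val.inv).continuousOn
  refine ⟨M ^ 2, sq_nonneg M, fun g => ?_⟩
  have htranslate (k : K) : ‖entries g‖ ^ 2 ≤ M ^ 2 * ‖entries (g * (k : G))‖ ^ 2 := by
    rw [← mul_pow]
    refine pow_le_pow_left₀ (norm_nonneg _) ?_ 2
    calc ‖entries g‖ = ‖entriesAction (k : G)⁻¹ (entries (g * (k : G)))‖ := by
          rw [← entries_mul, mul_inv_cancel_right]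
      _ ≤ M * ‖entries (g * (k : G))‖ :=
          (entriesAction _).le_of_opNorm_le (hM k (Set.mem_univ k)) _
  have hint : Integrable (fun k : K => ‖entries (g * (k : G))‖ ^ 2) ν :=
    ((expSmooth_entries.continuous.comp (continuous_const.mul
      continuous_subtype_val)).norm.pow 2).integrable_of_hasCompactSupport (.of_compactSpace _)
  calc ‖entries g‖ ^ 2 = ∫ _ : K, ‖entries g‖ ^ 2 ∂ν := by
        rw [integral_const, probReal_univ, one_smul]
    _ ≤ ∫ k : K, M ^ 2 * ‖entries (g * (k : G))‖ ^ 2 ∂ν :=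
        integral_mono (integrable_const _) (hint.const_mul _) htranslate
    _ ≤ M ^ 2 * averagedNormSq ν g := by
        rw [integral_const_mul, averagedNormSq]
        exact mul_le_mul_of_nonneg_left (le_add_of_nonneg_left zero_le_one) (sq_nonneg M)

theorem isCompact_averagedNormSq_le [IsProbabilityMeasure ν] (R : ℝ) :
    IsCompact {g : G | averagedNormSq ν g ≤ R} := by
  obtain ⟨M, hM0, hM⟩ := exists_norm_sq_entries_le ν
  refine (isCompact_norm_entries_le √(M * R)).of_isClosed_subset
    (isClosed_le (expSmooth_averagedNormSq ν).continuous continuous_const) fun g hg => ?_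
  exact Real.le_sqrt_of_sq_le ((hM g).trans (mul_le_mul_of_nonneg_left hg hM0))

theorem exists_abs_groupDeriv_averagedNormSq_le [IsProbabilityMeasure ν] (Y : lieAlgebra G) :
    ∃ C : ℝ, 0 ≤ C ∧ ∀ g, |groupDeriv Y (averagedNormSq ν) g| ≤ C * averagedNormSq ν g := by
  obtain ⟨M, hM0, hM⟩ := exists_norm_sq_entries_le ν
  let T := averagedGram ν
  let L : EntrySpace n →L[ℝ] EntrySpace n := groupDeriv Y entriesAction (1 : G)
  refine ⟨2 * ‖T‖ * ‖L‖ * M, by positivity, fun g => ?_⟩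
  have hderiv : groupDeriv Y (averagedNormSq ν) g =
      inner ℝ (T (entries g)) (L (entries g)) + inner ℝ (T (L (entries g))) (entries g) := by
    have hentries := hasDerivAt_entries Y g
    have hinner := ((T.hasFDerivAt.comp_hasDerivAt _ hentries).inner ℝ hentries).const_add 1
    simp only [Function.comp_apply, zero_smul, expG_zero, mul_one] at hinner
    rw [groupDeriv]
    simp only [averagedNormSq_eq_inner]
    exact hinner.deriv
  calc |groupDeriv Y (averagedNormSq ν) g|
      ≤ ‖T (entries g)‖ * ‖L (entries g)‖ + ‖T (L (entries g))‖ * ‖entries g‖ := by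
        rw [hderiv]
        exact (abs_add_le _ _).trans
          (add_le_add (abs_real_inner_le_norm _ _) (abs_real_inner_le_norm _ _))
    _ ≤ (‖T‖ * ‖entries g‖) * (‖L‖ * ‖entries g‖) +
        (‖T‖ * (‖L‖ * ‖entries g‖)) * ‖entries g‖ := by
        gcongr
        · exact T.le_opNorm _
        · exact L.le_opNorm _
        · exact T.le_opNorm_of_le (L.le_opNorm _)
    _ = 2 * ‖T‖ * ‖L‖ * ‖entries g‖ ^ 2 := by ring
    _ ≤ 2 * ‖T‖ * ‖L‖ * M * averagedNormSq ν g := by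
        rw [mul_assoc _ M]
        exact mul_le_mul_of_nonneg_left (hM g) (by positivity)

end AveragedNorm

section Cutoff

variable {n : ℕ} {G : ClosedSubgroup (GL (Fin n) ℝ)} {K : Subgroup G}

/-- A smooth proper function on `G ⧸ K`, seen as a function on `G`, with values in `[1, ∞)` whose
logarithm has bounded derivatives along the left invariant vector fields. -/
structure IsLogExhaustion (K : Subgroup G) (N : G → ℝ) : Prop where
  one_le : ∀ g, 1 ≤ N g
  smooth : ExpSmooth N
  invariant : ∀ g, ∀ k ∈ K, N (g * k) = N g
  isCompact_le : ∀ R, IsCompact {g | N g ≤ R}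
  exists_abs_groupDeriv_le : ∀ Y, ∃ C : ℝ, 0 ≤ C ∧ ∀ g, |groupDeriv Y N g| ≤ C * N g

theorem exists_isLogExhaustion (hK : IsCompact (K : Set G)) : ∃ N, IsLogExhaustion K N := by
  have : CompactSpace K := isCompact_iff_compactSpace.1 hK
  let _ : MeasurableSpace K := borel K
  have : BorelSpace K := ⟨rfl⟩
  let ν : Measure K := Measure.haarMeasure ⊤
  have : IsProbabilityMeasure ν := ⟨Measure.haarMeasure_self⟩
  exact ⟨averagedNormSq ν, one_le_averagedNormSq ν, expSmooth_averagedNormSq ν,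
    fun g _ hk => averagedNormSq_mul ν g hk, isCompact_averagedNormSq_le ν,
    exists_abs_groupDeriv_averagedNormSq_le ν⟩

/-- A smooth cutoff function on `G ⧸ K`, seen as a function on `G`, which is `1` near `Q` and whose
derivatives along the vector fields `e` are bounded by `C`. -/
structure IsCutoff {ι : Type*} (K : Subgroup G) (e : ι → lieAlgebra G) (Q : Set G) (C : ℝ)
    (χ : G → ℝ) : Prop where
  smooth : ExpSmooth χ
  invariant : ∀ g, ∀ k ∈ K, χ (g * k) = χ g
  compact : HasCompactSupport χ
  abs_le_one : ∀ g, |χ g| ≤ 1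
  eventuallyEq_one : ∀ g ∈ Q, χ =ᶠ[𝓝 g] 1
  abs_groupDeriv_le : ∀ i g, |groupDeriv (e i) χ g| ≤ C

namespace IsLogExhaustion

variable {N : G → ℝ}

theorem pos (hN : IsLogExhaustion K N) (g : G) : 0 < N g :=
  one_pos.trans_le (hN.one_le g)

theorem continuous_log (hN : IsLogExhaustion K N) : Continuous fun g => Real.log (N g) :=
  hN.smooth.continuous.log fun g => (hN.pos g).ne'

theorem expSmooth_bump_log (hN : IsLogExhaustion K N) (f : ContDiffBump (0 : ℝ)) (R : ℝ) :
    ExpSmooth fun g => f (Real.log (N g) / R) :=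
  fun g m Y => f.contDiff.comp (((hN.smooth g m Y).log fun _ => (hN.pos _).ne').div_const R)

theorem hasCompactSupport_bump_log (hN : IsLogExhaustion K N) (f : ContDiffBump (0 : ℝ)) {R : ℝ}
    (hR : 0 < R) : HasCompactSupport fun g => f (Real.log (N g) / R) := by
  refine .of_support_subset_isCompact (hN.isCompact_le (Real.exp (f.rOut * R))) fun g hg => ?_
  have hball : Real.log (N g) / R ∈ Metric.ball 0 f.rOut := f.support_eq ▸ hg
  rw [mem_ball_zero_iff, Real.norm_eq_abs] at hball
  exact ((Real.log_lt_iff_lt_exp (hN.pos g)).1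
    ((div_lt_iff₀ hR).1 ((le_abs_self _).trans_lt hball))).le

theorem bump_log_eventuallyEq_one (hN : IsLogExhaustion K N) (f : ContDiffBump (0 : ℝ)) {R : ℝ}
    (hR : 0 < R) {g : G} (hg : Real.log (N g) < f.rIn * R) :
    (fun g => f (Real.log (N g) / R)) =ᶠ[𝓝 g] 1 := by
  filter_upwards [(isOpen_lt hN.continuous_log continuous_const).mem_nhds hg] with h hh
  refine f.one_of_mem_closedBall (mem_closedBall_zero_iff.2 ?_)
  rw [Real.norm_of_nonneg (div_nonneg (Real.log_nonneg (hN.one_le h)) hR.le), div_le_iff₀ hR]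
  exact le_of_lt hh

theorem abs_groupDeriv_bump_log_le (hN : IsLogExhaustion K N) (f : ContDiffBump (0 : ℝ)) {B C R : ℝ}
    (hB : ∀ x, |deriv f x| ≤ B) (hR : 1 ≤ R) {Y : lieAlgebra G} {g : G}
    (hC : |groupDeriv Y N g| ≤ C * N g) :
    |groupDeriv Y (fun g => f (Real.log (N g) / R)) g| ≤ B * C := by
  have hNg := hN.pos g
  have hR0 : 0 < R := one_pos.trans_le hR
  have hderiv : groupDeriv Y (fun g => f (Real.log (N g) / R)) g =
      deriv f (Real.log (N g) / R) * (groupDeriv Y N g / N g / R) := by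
    have hlog := ((hN.smooth.hasDerivAt Y g).log (hN.pos _).ne').div_const R
    have hbump := ((f.contDiff.differentiable (n := ∞) (by simp) _).hasDerivAt).comp (0 : ℝ) hlog
    simp only [zero_smul, expG_zero, mul_one] at hbump
    exact hbump.deriv
  rw [hderiv, abs_mul]
  refine mul_le_mul (hB _) ?_ (abs_nonneg _) ((abs_nonneg _).trans (hB 0))
  rw [abs_div, abs_div, abs_of_pos hNg, abs_of_pos hR0]
  exact (div_le_self (by positivity) hR).trans ((div_le_iff₀ hNg).2 hC)

end IsLogExhaustion

theorem exists_isCutoff (hK : IsCompact (K : Set G)) {ι : Type*} [Finite ι]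
    (e : ι → lieAlgebra G) : ∃ C : ℝ, ∀ Q : Set G, IsCompact Q → ∃ χ, IsCutoff K e Q C χ := by
  cases nonempty_fintype ι
  obtain ⟨N, hN⟩ := exists_isLogExhaustion hK
  choose C hC0 hC using hN.exists_abs_groupDeriv_le
  let f : ContDiffBump (0 : ℝ) := ⟨1, 2, one_pos, one_lt_two⟩
  obtain ⟨B, hB⟩ : ∃ B, ∀ x, |deriv f x| ≤ B :=
    (f.contDiff.continuous_deriv (n := ∞) (by simp)).bounded_above_of_compact_support
      f.hasCompactSupport.deriv
  have hB0 : 0 ≤ B := (abs_nonneg _).trans (hB 0)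
  refine ⟨∑ i, B * C (e i), fun Q hQ => ?_⟩
  obtain ⟨b, hb⟩ := (hQ.image hN.continuous_log).bddAbove
  let R : ℝ := max 1 (b + 1)
  have hR : 1 ≤ R := le_max_left _ _
  have hR0 : 0 < R := one_pos.trans_le hR
  refine ⟨fun g => f (Real.log (N g) / R), hN.expSmooth_bump_log f R,
    fun g k hk => by rw [hN.invariant g k hk], hN.hasCompactSupport_bump_log f hR0,
    fun g => (abs_of_nonneg f.nonneg).trans_le f.le_one,
    fun g hg => hN.bump_log_eventuallyEq_one f hR0 ?_, fun i g => ?_⟩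
  · change _ < 1 * R
    rw [one_mul]
    exact (lt_add_of_le_of_pos (hb (Set.mem_image_of_mem _ hg)) one_pos).trans_le
      (le_max_right _ _)
  · exact (hN.abs_groupDeriv_bump_log_le f hB hR (hC (e i) g)).trans
      (Finset.single_le_sum (f := fun i => B * C (e i))
        (fun i _ => mul_nonneg hB0 (hC0 (e i))) (Finset.mem_univ i))

end Cutoff

end

noncomputable section

/-! ### Transplanting test functions between `X` and `Γ\X` -/

section Transplantation

open RightCosets

variable {n d : ℕ} {G : ClosedSubgroup (GL (Fin n) ℝ)} {K Γ : Subgroup G}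

/-- The elements of `C_c^∞(G/K)`, seen as functions on `G`. -/
structure IsGroupTestFunction (K : Subgroup G) (u : G → ℂ) : Prop where
  smooth : ExpSmooth u
  invariant : ∀ g, ∀ k ∈ K, u (g * k) = u g
  compact : HasCompactSupport u

theorem isClosedEmbedding_cosetMap_bot (g : G) :
    IsClosedEmbedding (cosetMap (⊥ : Subgroup G) g) where
  toIsEmbedding := (IsOpenEmbedding.of_continuous_injective_isOpenMap (continuous_cosetMap _ _)
    (cosetMap_bot_injective g) (isOpenMap_cosetMap _ _)).isEmbedding
  isClosed_range := by
    rw [(cosetMap_surjective _ _).range_eq]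
    exact isClosed_univ

theorem IsTestFunction.isGroupTestFunction {f : RightCosets (⊥ : Subgroup G) → ℂ}
    (hf : IsTestFunction K ⊥ f) (g : G) : IsGroupTestFunction K fun h => f (cosetMap ⊥ g h) where
  smooth := hf.expSmooth g
  invariant h _ hk := hf.comp_cosetMap_mul g h hk
  compact := hf.compact.comp_isClosedEmbedding (isClosedEmbedding_cosetMap_bot g)

theorem pushFun_bot_comp_cosetMap (f : RightCosets (⊥ : Subgroup G) → ℂ) (g : G) :
    pushFun ⊥ g Set.univ (fun h => f (cosetMap ⊥ g h)) = f := by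
  funext x
  obtain ⟨h, rfl⟩ := cosetMap_surjective ⊥ g x
  exact pushFun_cosetMap (cosetMap_bot_injective g).injOn (Set.mem_univ h)

section PushFun

variable {g : G} {U : Set G} {u : G → ℂ}

theorem lieDeriv_pushFun (hUo : IsOpen U) (hU : Set.InjOn (cosetMap Γ g) U) (Y : lieAlgebra G)
    {h : G} (hh : h ∈ U) : lieDeriv Y (pushFun Γ g U u) (cosetMap Γ g h) = groupDeriv Y u h := by
  rw [← groupDeriv_comp_cosetMap]
  refine groupDeriv_eq_of_eventuallyEq ?_ Y
  filter_upwards [hUo.mem_nhds hh] with y hy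
  exact pushFun_cosetMap hU hy

theorem pushFun_op_smul (hU : Set.InjOn (cosetMap Γ g) U) (huU : Function.support u ⊆ U)
    (hu : ∀ g, ∀ k ∈ K, u (g * k) = u g) {k : G} (hk : k ∈ K) (x : RightCosets Γ) :
    pushFun Γ g U u (MulOpposite.op k • x) = pushFun Γ g U u x := by
  have hsupport {k : G} (hk : k ∈ K) {x : RightCosets Γ} (hx : pushFun Γ g U u x ≠ 0) :
      pushFun Γ g U u (MulOpposite.op k • x) = pushFun Γ g U u x := by
    obtain ⟨h, ⟨hhU, hh⟩, rfl⟩ := support_pushFun_subset hU hx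
    have hhk : h * k ∈ U := huU (by rwa [Function.mem_support, hu h k hk])
    rw [op_smul_cosetMap, pushFun_cosetMap hU hhk, pushFun_cosetMap hU hhU, hu h k hk]
  by_cases hx : pushFun Γ g U u x = 0
  · by_contra hkx
    refine hkx ((hsupport (inv_mem hk) (hx ▸ hkx)).symm.trans ?_)
    rw [smul_smul, ← MulOpposite.op_mul, mul_inv_cancel, MulOpposite.op_one, one_smul]
  · exact hsupport hk hx

variable [DiscreteTopology Γ]

theorem contDiff_pushFun (hu : ExpSmooth u) (hucompact : HasCompactSupport u) (hUo : IsOpen U)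
    (hU : Set.InjOn (cosetMap Γ g) U) (huU : tsupport u ⊆ U) (x : RightCosets Γ) {m : ℕ}
    (Y : Fin m → lieAlgebra G) : ContDiff ℝ ∞ fun t : Fin m → ℝ =>
      pushFun Γ g U u (MulOpposite.op (expG (∑ i, t i • Y i)) • x) := by
  refine contDiff_iff_contDiffAt.2 fun t₀ => ?_
  by_cases hx : MulOpposite.op (expG (∑ i, t₀ i • Y i)) • x ∈ cosetMap Γ g '' tsupport u
  · obtain ⟨h, hh, hhx⟩ := hx
    let a : G := h * (expG (∑ i, t₀ i • Y i))⁻¹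
    have hxa : x = cosetMap Γ g a := by
      rw [← op_smul_cosetMap, hhx, smul_smul, ← MulOpposite.op_mul, mul_inv_cancel,
        MulOpposite.op_one, one_smul]
    have haU : a * expG (∑ i, t₀ i • Y i) ∈ U := by
      rw [inv_mul_cancel_right]
      exact huU hh
    refine (hu a m Y).contDiffAt.congr_of_eventuallyEq ?_
    filter_upwards [(continuous_mul_expG_sum a Y).continuousAt.eventually (hUo.mem_nhds haU)]
      with t ht
    rw [hxa, op_smul_cosetMap, pushFun_cosetMap hU ht]
  · have hclosed : IsClosed (cosetMap Γ g '' tsupport u) :=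
      (hucompact.isCompact.image (continuous_cosetMap Γ g)).isClosed
    obtain ⟨a, rfl⟩ := cosetMap_surjective Γ g x
    simp only [op_smul_cosetMap] at hx ⊢
    have hcont : Continuous fun t : Fin m → ℝ => cosetMap Γ g (a * expG (∑ i, t i • Y i)) :=
      (continuous_cosetMap Γ g).comp (continuous_mul_expG_sum a Y)
    refine (contDiffAt_const (c := (0 : ℂ))).congr_of_eventuallyEq ?_
    filter_upwards [hcont.continuousAt.eventually (hclosed.isOpen_compl.mem_nhds hx)] with t ht
    exact image_eq_zero_of_notMem_tsupport fun h => ht (tsupport_pushFun_subset hU hucompact h)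

theorem IsGroupTestFunction.isTestFunction_pushFun (hu : IsGroupTestFunction K u) (hUo : IsOpen U)
    (hU : Set.InjOn (cosetMap Γ g) U) (huU : tsupport u ⊆ U) :
    IsTestFunction K Γ (pushFun Γ g U u) where
  smooth x _ Y := contDiff_pushFun hu.smooth hu.compact hUo hU huU x Y
  invariant _ hk x := pushFun_op_smul hU ((subset_tsupport u).trans huU) hu.invariant hk x
  compact := hasCompactSupport_pushFun hU hu.compact

theorem lieDeriv_pushFun_eq_zero (hu : HasCompactSupport u) (hU : Set.InjOn (cosetMap Γ g) U)
    (huU : tsupport u ⊆ U) (Y : lieAlgebra G) {x : RightCosets Γ} (hx : x ∉ cosetMap Γ g '' U) :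
    lieDeriv Y (pushFun Γ g U u) x = 0 :=
  lieDeriv_eq_zero (fun hxu => hx (Set.image_mono huU (tsupport_pushFun_subset hU hu hxu))) Y

variable [MeasurableSpace G] [BorelSpace G] (μ : Measure G) [μ.IsHaarMeasure]

theorem integral_eq_integral_of_comp_cosetMap {F : Type*} [NormedAddCommGroup F] [NormedSpace ℝ F]
    [SecondCountableTopology F] (hUo : IsOpen U) (hU : Set.InjOn (cosetMap Γ g) U)
    {Φ : RightCosets Γ → F} {w : G → F} (hΦ : Continuous Φ)
    (hΦ0 : ∀ x ∉ cosetMap Γ g '' U, Φ x = 0) (hw0 : ∀ h ∉ U, w h = 0)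
    (hΦw : ∀ h ∈ U, Φ (cosetMap Γ g h) = w h) :
    ∫ x, Φ x ∂(quotientMeasure Γ μ) = ∫ h, w h ∂μ := by
  rw [integral_eq_setIntegral_cosetMap μ hUo hU hΦ hΦ0,
    ← setIntegral_eq_integral_of_forall_compl_eq_zero hw0]
  exact setIntegral_congr_fun hUo.measurableSet hΦw

theorem energy_pushFun (hu : IsGroupTestFunction K u) (hUo : IsOpen U)
    (hU : Set.InjOn (cosetMap Γ g) U) (huU : tsupport u ⊆ U) (e : Fin d → lieAlgebra G) :
    energy μ e (pushFun Γ g U u) =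
      ∫ h, ‖u h‖ ^ 2 ∂μ + ∑ i, ∫ h, ‖groupDeriv (e i) u h‖ ^ 2 ∂μ := by
  have hpush := hu.isTestFunction_pushFun hUo hU huU
  rw [energy]
  congr 1
  · refine integral_eq_integral_of_comp_cosetMap μ hUo hU (hpush.continuous.norm.pow 2)
      (fun x hx => ?_) (fun h hh => ?_) fun h hh => ?_
    · rw [pushFun_eq_zero hx, norm_zero, zero_pow two_ne_zero]
    · rw [image_eq_zero_of_notMem_tsupport fun hhu => hh (huU hhu), norm_zero,
        zero_pow two_ne_zero]
    · rw [pushFun_cosetMap hU hh]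
  · refine Finset.sum_congr rfl fun i _ => integral_eq_integral_of_comp_cosetMap μ hUo hU
      ((hpush.continuous_lieDeriv (e i)).norm.pow 2) (fun x hx => ?_) (fun h hh => ?_)
      fun h hh => ?_
    · rw [lieDeriv_pushFun_eq_zero hu.compact hU huU _ hx, norm_zero, zero_pow two_ne_zero]
    · rw [groupDeriv_eq_zero fun hhu => hh (huU hhu), norm_zero, zero_pow two_ne_zero]
    · rw [lieDeriv_pushFun hUo hU (e i) hh]

theorem shiftedForm_pushFun (hu : IsGroupTestFunction K u) (hUo : IsOpen U)
    (hU : Set.InjOn (cosetMap Γ g) U) (huU : tsupport u ⊆ U) (e : Fin d → lieAlgebra G)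
    (z : ℂ) {ψ : RightCosets Γ → ℂ} (hψ : IsTestFunction K Γ ψ) :
    shiftedForm μ e z (pushFun Γ g U u) ψ =
      ∑ i, ∫ h, conj (groupDeriv (e i) (fun h => ψ (cosetMap Γ g h)) h) * groupDeriv (e i) u h ∂μ -
        z * ∫ h, conj (ψ (cosetMap Γ g h)) * u h ∂μ := by
  have hpush := hu.isTestFunction_pushFun hUo hU huU
  rw [shiftedForm]
  congr 2
  · refine funext fun i => integral_eq_integral_of_comp_cosetMap μ hUo hU
      ((Complex.continuous_conj.comp (hψ.continuous_lieDeriv (e i))).mul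
        (hpush.continuous_lieDeriv (e i))) (fun x hx => ?_) (fun h hh => ?_) fun h hh => ?_
    · rw [lieDeriv_pushFun_eq_zero hu.compact hU huU _ hx, mul_zero]
    · rw [groupDeriv_eq_zero (u := u) fun hhu => hh (huU hhu), mul_zero]
    · rw [lieDeriv_pushFun hUo hU (e i) hh, groupDeriv_comp_cosetMap]
  · refine integral_eq_integral_of_comp_cosetMap μ hUo hU
      ((Complex.continuous_conj.comp hψ.continuous).mul hpush.continuous)
      (fun x hx => ?_) (fun h hh => ?_) fun h hh => ?_
    · rw [pushFun_eq_zero hx, mul_zero]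
    · rw [image_eq_zero_of_notMem_tsupport fun hhu => hh (huU hhu), mul_zero]
    · rw [pushFun_cosetMap hU hh]

theorem integral_le_of_le_comp_cosetMap (hUo : IsOpen U) (hU : Set.InjOn (cosetMap Γ g) U)
    {Φ : RightCosets Γ → ℝ} (hΦ : Continuous Φ) (hΦ0 : 0 ≤ Φ)
    (hΦint : Integrable Φ (quotientMeasure Γ μ)) {w : G → ℝ} (hw0 : 0 ≤ w)
    (hw : ∀ h ∈ U, w h ≤ Φ (cosetMap Γ g h)) (hwU : ∀ h ∉ U, w h = 0) :
    ∫ h, w h ∂μ ≤ ∫ x, Φ x ∂(quotientMeasure Γ μ) := by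
  have hint : IntegrableOn (fun h => Φ (cosetMap Γ g h)) U μ := by
    have hmap : Integrable Φ ((μ.restrict U).map (cosetMap Γ g)) := by
      rw [← restrict_image_cosetMap_quotientMeasure μ hUo hU]
      exact hΦint.restrict
    exact (integrable_map_measure hΦ.aestronglyMeasurable
      (continuous_cosetMap Γ g).aemeasurable).1 hmap
  calc ∫ h, w h ∂μ = ∫ h in U, w h ∂μ :=
        (setIntegral_eq_integral_of_forall_compl_eq_zero hwU).symm
    _ ≤ ∫ h in U, Φ (cosetMap Γ g h) ∂μ :=
        integral_mono_of_nonneg (Eventually.of_forall hw0) hint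
          (ae_restrict_of_forall_mem hUo.measurableSet hw)
    _ = ∫ x in cosetMap Γ g '' U, Φ x ∂(quotientMeasure Γ μ) :=
        (setIntegral_image_cosetMap μ hUo hU hΦ).symm
    _ ≤ ∫ x, Φ x ∂(quotientMeasure Γ μ) :=
        setIntegral_le_integral hΦint (Eventually.of_forall hΦ0)

end PushFun

namespace IsCutoff

variable {e : Fin d → lieAlgebra G} {Q : Set G} {C : ℝ} {χ : G → ℝ} {ψ : RightCosets Γ → ℂ}

theorem isGroupTestFunction_smul (hχ : IsCutoff K e Q C χ) (hψ : IsTestFunction K Γ ψ) (g : G) :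
    IsGroupTestFunction K fun h => χ h • ψ (cosetMap Γ g h) where
  smooth h m Y := (hχ.smooth h m Y).smul (hψ.expSmooth g h m Y)
  invariant h k hk := by rw [hχ.invariant h k hk, hψ.comp_cosetMap_mul g h hk]
  compact := hχ.compact.smul_right

theorem norm_sq_smul_le (hχ : IsCutoff K e Q C χ) (ψ : RightCosets Γ → ℂ) (g h : G) :
    ‖χ h • ψ (cosetMap Γ g h)‖ ^ 2 ≤ ‖ψ (cosetMap Γ g h)‖ ^ 2 := by
  rw [norm_smul]
  exact pow_le_pow_left₀ (by positivity)
    (mul_le_of_le_one_left (norm_nonneg _) (hχ.abs_le_one h)) 2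

theorem norm_sq_groupDeriv_smul_le (hχ : IsCutoff K e Q C χ) (hψ : IsTestFunction K Γ ψ) (i : Fin d)
    (g h : G) : ‖groupDeriv (e i) (fun h => χ h • ψ (cosetMap Γ g h)) h‖ ^ 2 ≤
      2 * ‖lieDeriv (e i) ψ (cosetMap Γ g h)‖ ^ 2 + 2 * C ^ 2 * ‖ψ (cosetMap Γ g h)‖ ^ 2 := by
  have hleibniz : groupDeriv (e i) (fun h => χ h • ψ (cosetMap Γ g h)) h =
      χ h • lieDeriv (e i) ψ (cosetMap Γ g h) + groupDeriv (e i) χ h • ψ (cosetMap Γ g h) := by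
    have hderiv := (hχ.smooth.hasDerivAt (e i) h).fun_smul ((hψ.expSmooth g).hasDerivAt (e i) h)
    simp only [zero_smul, expG_zero, mul_one, groupDeriv_comp_cosetMap] at hderiv
    exact hderiv.deriv
  have hnorm : ‖groupDeriv (e i) (fun h => χ h • ψ (cosetMap Γ g h)) h‖ ≤
      ‖lieDeriv (e i) ψ (cosetMap Γ g h)‖ + C * ‖ψ (cosetMap Γ g h)‖ := by
    rw [hleibniz]
    refine (norm_add_le _ _).trans (add_le_add ?_ ?_)
    · rw [norm_smul]
      exact mul_le_of_le_one_left (norm_nonneg _) (hχ.abs_le_one h)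
    · rw [norm_smul]
      exact mul_le_mul_of_nonneg_right (hχ.abs_groupDeriv_le i h) (norm_nonneg _)
  calc _ ≤ (‖lieDeriv (e i) ψ (cosetMap Γ g h)‖ + C * ‖ψ (cosetMap Γ g h)‖) ^ 2 :=
        pow_le_pow_left₀ (norm_nonneg _) hnorm 2
    _ ≤ 2 * (‖lieDeriv (e i) ψ (cosetMap Γ g h)‖ ^ 2 + (C * ‖ψ (cosetMap Γ g h)‖) ^ 2) :=
        add_sq_le
    _ = _ := by ring

variable [DiscreteTopology Γ] [MeasurableSpace G] [BorelSpace G] (μ : Measure G) [μ.IsHaarMeasure]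
  {g : G} {U : Set G}

theorem integral_norm_sq_groupDeriv_smul_le (hχ : IsCutoff K e Q C χ) (hψ : IsTestFunction K Γ ψ)
    (hUo : IsOpen U) (hU : Set.InjOn (cosetMap Γ g) U) (hχU : tsupport χ ⊆ U) (i : Fin d) :
    ∫ h, ‖groupDeriv (e i) (fun h => χ h • ψ (cosetMap Γ g h)) h‖ ^ 2 ∂μ ≤
      2 * ∫ x, ‖lieDeriv (e i) ψ x‖ ^ 2 ∂(quotientMeasure Γ μ) +
        2 * C ^ 2 * ∫ x, ‖ψ x‖ ^ 2 ∂(quotientMeasure Γ μ) := by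
  have hsupp : tsupport (fun h => χ h • ψ (cosetMap Γ g h)) ⊆ U :=
    (closure_mono (Function.support_smul_subset_left χ _)).trans hχU
  have hintψ := ((hψ.memLp μ).integrable_norm_pow two_ne_zero).const_mul (2 * C ^ 2)
  have hintD := ((hψ.memLp_lieDeriv μ (e i)).integrable_norm_pow two_ne_zero).const_mul 2
  have hcontψ := (hψ.continuous.norm.pow 2).const_mul (2 * C ^ 2)
  have hcontD := ((hψ.continuous_lieDeriv (e i)).norm.pow 2).const_mul 2
  rw [← integral_const_mul, ← integral_const_mul, ← integral_add hintD hintψ]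
  have hnonneg (x : RightCosets Γ) :
      0 ≤ 2 * ‖lieDeriv (e i) ψ x‖ ^ 2 + 2 * C ^ 2 * ‖ψ x‖ ^ 2 := by positivity
  refine integral_le_of_le_comp_cosetMap μ hUo hU (hcontD.add hcontψ) hnonneg (hintD.add hintψ)
    (fun h => sq_nonneg _) (fun h _ => hχ.norm_sq_groupDeriv_smul_le hψ i g h) fun h hh => ?_
  rw [groupDeriv_eq_zero fun hhu => hh (hsupp hhu), norm_zero, zero_pow two_ne_zero]

theorem energy_pushFun_smul_le (hχ : IsCutoff K e Q C χ) (hψ : IsTestFunction K Γ ψ)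
    (hUo : IsOpen U) (hU : Set.InjOn (cosetMap Γ g) U) (hχU : tsupport χ ⊆ U) :
    energy μ e (pushFun ⊥ 1 Set.univ fun h => χ h • ψ (cosetMap Γ g h)) ≤
      (2 + 2 * d * C ^ 2) * energy μ e ψ := by
  rw [energy_pushFun μ (hχ.isGroupTestFunction_smul hψ g) isOpen_univ
    (cosetMap_bot_injective 1).injOn (Set.subset_univ _), energy]
  set massψ := ∫ x, ‖ψ x‖ ^ 2 ∂(quotientMeasure Γ μ)
  set dirichletψ := ∑ i, ∫ x, ‖lieDeriv (e i) ψ x‖ ^ 2 ∂(quotientMeasure Γ μ)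
  have hmass : ∫ h, ‖χ h • ψ (cosetMap Γ g h)‖ ^ 2 ∂μ ≤ massψ := by
    refine integral_le_of_le_comp_cosetMap μ hUo hU (hψ.continuous.norm.pow 2)
      (fun x => sq_nonneg _) ((hψ.memLp μ).integrable_norm_pow two_ne_zero)
      (fun h => sq_nonneg _) (fun h _ => hχ.norm_sq_smul_le ψ g h) fun h hh => ?_
    rw [image_eq_zero_of_notMem_tsupport fun hhχ => hh (hχU hhχ), zero_smul, norm_zero,
      zero_pow two_ne_zero]
  have hdirichlet : ∑ i, ∫ h, ‖groupDeriv (e i) (fun h => χ h • ψ (cosetMap Γ g h)) h‖ ^ 2 ∂μ ≤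
      2 * dirichletψ + d * (2 * C ^ 2 * massψ) := by
    refine (Finset.sum_le_sum fun i _ =>
      hχ.integral_norm_sq_groupDeriv_smul_le μ hψ hUo hU hχU i).trans_eq ?_
    rw [Finset.sum_add_distrib, ← Finset.mul_sum, Finset.sum_const, Finset.card_univ,
      Fintype.card_fin, nsmul_eq_mul]
  have hmass0 : 0 ≤ massψ := integral_nonneg fun x => sq_nonneg _
  have hdirichlet0 : 0 ≤ 2 * d * C ^ 2 * dirichletψ :=
    mul_nonneg (by positivity) (Finset.sum_nonneg fun i _ => integral_nonneg fun x => sq_nonneg _)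
  linarith

theorem shiftedForm_pushFun_eq {u : G → ℂ} (hχ : IsCutoff K e (tsupport u) C χ)
    (hu : IsGroupTestFunction K u) (hψ : IsTestFunction K Γ ψ) (hUo : IsOpen U)
    (hU : Set.InjOn (cosetMap Γ g) U) (huU : tsupport u ⊆ U) (z : ℂ) :
    shiftedForm μ e z (pushFun Γ g U u) ψ =
      shiftedForm μ e z (pushFun ⊥ 1 Set.univ u)
        (pushFun ⊥ 1 Set.univ fun h => χ h • ψ (cosetMap Γ g h)) := by
  have hbot := (cosetMap_bot_injective (1 : G)).injOn (s := Set.univ)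
  rw [shiftedForm_pushFun μ hu hUo hU huU e z hψ,
    shiftedForm_pushFun μ hu isOpen_univ hbot (Set.subset_univ _) e z
      ((hχ.isGroupTestFunction_smul hψ g).isTestFunction_pushFun isOpen_univ hbot
        (Set.subset_univ _))]
  simp only [pushFun_cosetMap hbot (Set.mem_univ _)]
  congr! 4 with i _ h h
  · by_cases hh : h ∈ tsupport u
    · congr 2
      refine groupDeriv_eq_of_eventuallyEq ?_ (e i)
      filter_upwards [hχ.eventuallyEq_one h hh] with y hy
      rw [hy, Pi.one_apply, one_smul]
    · rw [groupDeriv_eq_zero hh, mul_zero, mul_zero]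
  · by_cases hh : h ∈ tsupport u
    · rw [(hχ.eventuallyEq_one h hh).self_of_nhds, Pi.one_apply, one_smul]
    · rw [image_eq_zero_of_notMem_tsupport hh, mul_zero, mul_zero]

end IsCutoff

theorem laplaceSpectrum_bot_subset_of_exists_injOn [MeasurableSpace G] [BorelSpace G]
    [DiscreteTopology Γ] (hK : IsCompact (K : Set G)) (e : Fin d → lieAlgebra G)
    (μ : Measure G) [μ.IsHaarMeasure] [μ.IsMulRightInvariant]
    (hinj : ∀ Q : Set G, IsCompact Q → ∃ g : G, Set.InjOn (cosetMap Γ g) Q) :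
    laplaceSpectrum K ⊥ μ e ⊆ laplaceSpectrum K Γ μ e := by
  intro z
  contrapose
  simp only [notMem_laplaceSpectrum_iff_exists_bound]
  rintro ⟨c, hc, hbound⟩
  obtain ⟨C, hcutoff⟩ := exists_isCutoff hK e
  have hratio : 0 < √(2 + 2 * d * C ^ 2) := Real.sqrt_pos.2 (by positivity)
  refine ⟨c / √(2 + 2 * d * C ^ 2), by positivity, fun f hf A hA hfA => ?_⟩
  let u (h : G) : ℂ := f (cosetMap ⊥ 1 h)
  have hu : IsGroupTestFunction K u := hf.isGroupTestFunction 1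
  rw [← pushFun_bot_comp_cosetMap f 1] at hfA ⊢
  obtain ⟨χ, hχ⟩ := hcutoff (tsupport u) hu.compact
  obtain ⟨Q, hQ, hsupp⟩ := exists_compact_superset (hu.compact.isCompact.union hχ.compact.isCompact)
  obtain ⟨huQ, hχQ⟩ := Set.union_subset_iff.1 hsupp
  obtain ⟨g, hg⟩ := hinj Q hQ
  have hQinj : Set.InjOn (cosetMap Γ g) (interior Q) := hg.mono interior_subset
  have hbot := (cosetMap_bot_injective (1 : G)).injOn (s := Set.univ)
  have henergy : energy μ e (pushFun ⊥ 1 Set.univ u) =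
      energy μ e (pushFun Γ g (interior Q) u) := by
    rw [energy_pushFun μ hu isOpen_interior hQinj huQ,
      energy_pushFun μ hu isOpen_univ hbot (Set.subset_univ _)]
  rw [henergy, div_mul_eq_mul_div, div_le_iff₀ hratio]
  refine hbound _ (hu.isTestFunction_pushFun isOpen_interior hQinj huQ) _ (by positivity)
    fun ψ hψ => ?_
  calc ‖shiftedForm μ e z (pushFun Γ g (interior Q) u) ψ‖
      ≤ A * √(energy μ e (pushFun ⊥ 1 Set.univ fun h => χ h • ψ (cosetMap Γ g h))) := by
        rw [hχ.shiftedForm_pushFun_eq μ hu hψ isOpen_interior hQinj huQ]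
        exact hfA _ ((hχ.isGroupTestFunction_smul hψ g).isTestFunction_pushFun isOpen_univ hbot
          (Set.subset_univ _))
    _ ≤ A * √((2 + 2 * d * C ^ 2) * energy μ e ψ) := by
        gcongr
        exact hχ.energy_pushFun_smul_le μ hψ isOpen_interior hQinj hχQ
    _ = A * √(2 + 2 * d * C ^ 2) * √(energy μ e ψ) := by
        rw [Real.sqrt_mul (by positivity), mul_assoc A]

end Transplantation

end

theorem mainTheorem8_general {n d : ℕ} {G : ClosedSubgroup (GL (Fin n) ℝ)} {K Γ : Subgroup G}
    [MeasurableSpace G] [BorelSpace G] [DiscreteTopology Γ] (hK : IsCompact (K : Set G))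
    (e : Fin d → lieAlgebra G) (μ : Measure G) [μ.IsHaarMeasure] [μ.IsMulRightInvariant]
    (hinj : ∀ Q : Set G, IsCompact Q → ∃ g : G, Set.InjOn (RightCosets.cosetMap Γ g) Q) :
    WeaklyContained (rightRep G G μ)
        (rightRep G (RightCosets Γ) (RightCosets.quotientMeasure Γ μ)) ∧
      laplaceSpectrum K ⊥ μ e ⊆ laplaceSpectrum K Γ μ e :=
  ⟨RightCosets.weaklyContained_of_exists_injOn μ Γ hinj,
    laplaceSpectrum_bot_subset_of_exists_injOn hK e μ hinj⟩

theorem mainTheorem8 {n : ℕ} (G : ClosedSubgroup (GL (Fin n) ℝ))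
    (hG : IsConnectedSemisimpleRealAlgebraic G)
    (K : Subgroup G) (θ : lieAlgebra G ≃ₗ⁅ℝ⁆ lieAlgebra G) (hK : IsCartanPair K θ)
    {d : ℕ} (e : Fin d → lieAlgebra G) (he : IsOrthonormalFrame θ e)
    [MeasurableSpace G] [BorelSpace G]
    (μ : Measure G) [μ.IsHaarMeasure] [μ.IsMulRightInvariant]
    (Γ : Subgroup G) [DiscreteTopology Γ] (hinj : injRadius θ Γ = ⊤) :
    WeaklyContained (rightRep G G μ)
        (rightRep G (RightCosets Γ) (RightCosets.quotientMeasure Γ μ)) ∧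
      laplaceSpectrum K ⊥ μ e ⊆ laplaceSpectrum K Γ μ e := by
  have := hG.preconnectedSpace
  exact mainTheorem8_general hK.isCompact e μ fun _ hQ => exists_injOn_of_injRadius_eq_top hinj hQ
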